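/- Let $G$ be a connected three-dimensional (unimodular) Lie group with a left-invariant Riemannian metric $g_G$, and let $\{e_1,e_2,e_3\}$ be an orthonormal basis of its Lie algebra with $$[e_2,e_3]=\lambda_1e_1,\qquad [e_3,e_1]=\lambda_2e_2,\qquad [e_1,e_2]=\lambda_3e_3,$$ where the structure constants are normalised as usual (Milnor): the signs of $(\lambda_1,\lambda_2,\lambda_3)$ are one of $(0,0,0)$, $(+,0,0)$, $(+,0,-)$, $(+,+,0)$, $(+,+,-)$, $(+,+,+)$, with $\lambda_1\ge\lambda_2$ in the case $(+,+,-)$ and $\lambda_1\ge\lambda_2\ge\lambda_3$ in the case $(+,+,+)$. Put $\mu_i=\frac12(\lambda_1+\lambda_2+\lambda_3)-\lambda_i$. Let $I\subset\mathbb R$ be a nonempty open interval, $f:I\to\,]0,+\infty[$ and $\phi:I\to\mathbb R$ smooth functions, and $V_2=ae_1+be_2+ce_3$, $a^2+b^2+c^2=1$, a unit left-invariant vector field on $G$. Consider the vector field $V=\phi(t)\partial_t+V_2$ on the warped product $I\times_fG$, that is, $I\times G$ with the metric $g=dt^2+f(t)^2g_G$. A smooth vector field $V$ is called harmonic if it is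 a critical point of the vertical energy $\frac12\int\|\nabla V\|^2\,v_g$ under compactly supported variations through vector fields, where $\nabla$ is the Levi-Civita connection of $g$. Then $V$ is a harmonic vector field if and only if there is $\epsilon\in\mathbb R$ such that $f$ is a solution on $I$ of $$(E_1):\quad xx''+2x'^2=\epsilon,$$ $\phi$ is a solution on $I$ of $$(E_0):\quad x''+3\frac{f'}{f}x'-3\Big(\frac{f'}{f}\Big)^2x=0,$$ and one of the following cases occurs: 1. $\lambda_1=\lambda_2=\lambda_3=0$, $\epsilon=0$, $f(t)=(\alpha t+\beta)^{1/3}$ on $I$ for some constants $\alpha,\beta\in\mathbb R$ with $\alpha t+\beta>0$ on $I$, and $V_2$ is arbitrary; 2. $\lambda_1>0$, $\lambda_2=\lambda_3=0$, $\epsilon=2\mu_1^2$, and $V_2$ is arbitrary; 3. $\lambda_1>0$, $\lambda_2=0$, $\lambda_3<0$, and either $\epsilon=\mu_1^2+\mu_2^2$ and $V_2=ae_1+ce_3$, or $\epsilon=2\mu_1^2$ and $V_2=\pm e_2$; 4. $\lambda_1>0$, $\lambda_2>0$, $\lambda_3=0$, and either $\epsilon=\mu_1^2+\mu_3^2$ and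 $V_2=ae_1+be_2$, or $\epsilon=2\mu_1^2$ and $V_2=\pm e_3$; 5. $\lambda_1=\lambda_2>0>\lambda_3$, and either $\epsilon=\mu_1^2+\mu_3^2$ and $V_2=ae_1+be_2$, or $\epsilon=2\mu_1^2$ and $V_2=\pm e_3$; 6. $\lambda_1>\lambda_2>0>\lambda_3$ or $\lambda_1>\lambda_2>\lambda_3>0$, and $\epsilon=\mu_i^2+\mu_j^2$, $V_2=\pm e_k$ with $\{i,j,k\}=\{1,2,3\}$; 7. $\lambda_1=\lambda_2=\lambda_3>0$, $\epsilon=2\mu_1^2$, and $V_2$ is arbitrary; 8. $\lambda_1>\lambda_2=\lambda_3>0$, and either $\epsilon=\mu_1^2+\mu_2^2$ and $V_2=be_2+ce_3$, or $\epsilon=2\mu_2^2$ and $V_2=\pm e_1$; 9. $\lambda_1=\lambda_2>\lambda_3>0$, and either $\epsilon=\mu_1^2+\mu_3^2$ and $V_2=ae_1+be_2$, or $\epsilon=2\mu_1^2$ and $V_2=\pm e_3$. -/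

import Mathlib

open scoped Manifold ContDiff
open Bundle MeasureTheory

noncomputable section

section Riemannian

/-! All manifolds below are finite-dimensional, real and without boundary. -/

variable {E : Type*} [NormedAddCommGroup E] [NormedSpace ℝ E]
  {H : Type*} [TopologicalSpace H] (I : ModelWithCorners ℝ E H)
  (M : Type*) [TopologicalSpace M] [ChartedSpace H M]

/-- A field of scalar-valued functions of two tangent vectors at the same point; Riemannian metrics
are given in this form. -/
abbrev MetricField : Type _ := ∀ p : M, TangentSpace I p → TangentSpace I p → ℝ

/-- Vector fields on `M`. -/
abbrev VField : Type _ := ∀ p : M, TangentSpace I p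

variable {I M}

/-- A smooth (`C^∞`) vector field. -/
def IsSmoothVField [IsManifold I ∞ M] (V : VField I M) : Prop :=
  ContMDiff I I.tangent ∞ (fun p : M => (⟨p, V p⟩ : TangentBundle I M))

/-- `nabla` is the Levi-Civita connection of the metric `g`: it is torsion free and
`v (g (Y, Z)) = g (∇_v Y, Z) + g (Y, ∇_v Z)`.
In Mathlib's argument order, `nabla Y p v` is `∇_v Y` at `p`. -/
structure IsLeviCivita [FiniteDimensional ℝ E] [IsManifold I ∞ M]
    (g : MetricField I M)
    (nabla : CovariantDerivative I E (fun p : M => TangentSpace I p)) : Prop where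
  torsion_free : nabla.torsion = 0
  metric : ∀ (p : M) (Y Z : VField I M),
    MDifferentiableAt I I.tangent (fun q : M => (⟨q, Y q⟩ : TangentBundle I M)) p →
    MDifferentiableAt I I.tangent (fun q : M => (⟨q, Z q⟩ : TangentBundle I M)) p →
    ∀ v : TangentSpace I p,
      mvfderiv I (fun q : M => g q (Y q) (Z q)) p v =
        g p (nabla Y p v) (Z p) + g p (Y p) (nabla Z p v)

/-- The Gram matrix of a family of tangent vectors at `p`. -/
def gramMatrix (g : MetricField I M) (p : M) {n : ℕ} (u : Fin n → TangentSpace I p) :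
    Matrix (Fin n) (Fin n) ℝ :=
  Matrix.of fun i j => g p (u i) (u j)

/-- A basis of the tangent space `T_p M` (which is a copy of the model space `E`). -/
def tangentBasis [FiniteDimensional ℝ E] (p : M) (i : Fin (Module.finrank ℝ E)) :
    TangentSpace I p :=
  (Module.finBasis ℝ E i : E)

/-- The squared (Hilbert-Schmidt) norm of an endomorphism `A` of `T_p M`, that is
`∑ g^{ij} g (A b_i, A b_j)` in a basis `b`, equivalently `∑ |A u_i|²` over an orthonormal basis. -/
def endoNormSq [FiniteDimensional ℝ E] (g : MetricField I M) (p : M)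
    (A : TangentSpace I p →L[ℝ] TangentSpace I p) : ℝ :=
  ∑ i, ∑ j, (gramMatrix g p (tangentBasis (I := I) p))⁻¹ i j *
    g p (A (tangentBasis p i)) (A (tangentBasis p j))

/-- The `i`-th coordinate vector, at the point with coordinates `y`, of the chart around `x₀`. -/
def coordVector [FiniteDimensional ℝ E] (x₀ : M) (y : E) (i : Fin (Module.finrank ℝ E)) :
    TangentSpace I ((extChartAt I x₀).symm y) :=
  mfderiv 𝓘(ℝ, E) I (extChartAt I x₀).symm y (Module.finBasis ℝ E i : E)

/-- The density `√(det g_{ij})` of the Riemannian volume in the chart around `x₀`. -/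
def volumeDensity [FiniteDimensional ℝ E] (g : MetricField I M) (x₀ : M) (y : E) : ℝ :=
  √(gramMatrix g ((extChartAt I x₀).symm y) (coordVector (I := I) x₀ y)).det

/-- The vertical energy `½ ∫_D |∇V|² dvol_g` of a vector field `V` over a set `D` inside the domain
of the chart around `x₀`, computed in this chart. (The energy of `V`, as a map into the tangent
bundle with the Sasaki metric, is this number plus the constant `(dim M / 2) vol (D)`.) -/
def verticalEnergy [FiniteDimensional ℝ E] [MeasurableSpace E] [BorelSpace E]
    [IsManifold I ∞ M] (g : MetricField I M)
    (nabla : CovariantDerivative I E (fun p : M => TangentSpace I p))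
    (x₀ : M) (D : Set M) (V : VField I M) : ℝ :=
  (1 / 2) * ∫ y in extChartAt I x₀ '' D,
    endoNormSq g ((extChartAt I x₀).symm y) (nabla V ((extChartAt I x₀).symm y)) *
      volumeDensity g x₀ y ∂(Module.finBasis ℝ E).addHaar

/-- `V` is a harmonic vector field on `(M, g)`: it is smooth, and it is a critical point of the
(vertical) energy under compactly supported variations `V + s W` through vector fields. As the first
variation is linear in `W`, the variations supported in a compact subset `D` of a coordinate domain
suffice: by a partition of unity every compactly supported `W` is a finite sum of these. -/
def IsHarmonicVectorField [FiniteDimensional ℝ E] [MeasurableSpace E] [BorelSpace E]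
    [IsManifold I ∞ M]
    (g : MetricField I M) (V : VField I M) : Prop :=
  IsSmoothVField V ∧
  ∃ nabla : CovariantDerivative I E (fun p : M => TangentSpace I p),
    IsLeviCivita g nabla ∧
    ∀ (x₀ : M) (D : Set M), IsCompact D → D ⊆ (chartAt H x₀).source →
      ∀ W : VField I M, IsSmoothVField W → (∀ p, p ∉ D → W p = 0) →
        HasDerivAt (fun s : ℝ => verticalEnergy g nabla x₀ D (V + s • W)) 0 0

end Riemannian

section WarpedProduct

/-- Three-dimensional Euclidean space, the model of `G`. -/
abbrev E3 : Type := EuclideanSpace ℝ (Fin 3)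

variable {G : Type*} [TopologicalSpace G] [ChartedSpace E3 G]

/-- The `∂_t`-component `dπ (u) ∈ T_t J = ℝ` of a tangent vector `u` of `J × G`. -/
def baseComponent (J : TopologicalSpace.Opens ℝ) (p : J × G)
    (u : TangentSpace (𝓘(ℝ, ℝ).prod (𝓡 3)) p) : ℝ :=
  mfderiv (𝓘(ℝ, ℝ).prod (𝓡 3)) 𝓘(ℝ, ℝ) (Prod.fst : J × G → J) p u

/-- The `G`-component `dσ (u) ∈ T_x G` of a tangent vector `u` of `J × G` at `p = (t, x)`. -/
def fiberComponent (J : TopologicalSpace.Opens ℝ) (p : J × G)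
    (u : TangentSpace (𝓘(ℝ, ℝ).prod (𝓡 3)) p) : TangentSpace (𝓡 3) p.2 :=
  mfderiv (𝓘(ℝ, ℝ).prod (𝓡 3)) (𝓡 3) (Prod.snd : J × G → G) p u

/-- The warped product metric `g = π^* (dt²) + (f ∘ π)² σ^* h` on `J × G`, where `J` is an open
subset of `ℝ`, `π` and `σ` are the projections and `h` is a metric on `G`. -/
def warpedMetric (J : TopologicalSpace.Opens ℝ) (f : ℝ → ℝ) (h : MetricField (𝓡 3) G) :
    MetricField (𝓘(ℝ, ℝ).prod (𝓡 3)) (J × G) := fun p u v =>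
  baseComponent J p u * baseComponent J p v +
    f (p.1 : ℝ) ^ 2 * h p.2 (fiberComponent J p u) (fiberComponent J p v)

/-- The vector field `φ(t) ∂_t + V₂` on `J × G`. -/
def sumField (J : TopologicalSpace.Opens ℝ) (φ : ℝ → ℝ) (V₂ : VField (𝓡 3) G) :
    VField (𝓘(ℝ, ℝ).prod (𝓡 3)) (J × G) := fun p =>
  ((φ (p.1 : ℝ), V₂ p.2) : ℝ × E3)

/-- A metric on a Lie group is left-invariant if all left translations are isometries. -/
def IsLeftInvariantMetric [Group G] (h : MetricField (𝓡 3) G) : Prop :=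
  ∀ (x y : G) (u v : TangentSpace (𝓡 3) y),
    h (x * y) (mfderiv (𝓡 3) (𝓡 3) (fun z : G => x * z) y u)
      (mfderiv (𝓡 3) (𝓡 3) (fun z : G => x * z) y v) = h y u v

end WarpedProduct

section Milnor

/-! The indices `0, 1, 2` of `Fin 3` stand for `1, 2, 3`. -/

/-- Milnor's numbers `μ_i = (λ_1 + λ_2 + λ_3) / 2 - λ_i`. -/
def milnorMu (lam : Fin 3 → ℝ) (i : Fin 3) : ℝ := (lam 0 + lam 1 + lam 2) / 2 - lam i

/-- `e` is an `h`-orthonormal basis of the Lie algebra with `[e_2, e_3] = λ_1 e_1`,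
`[e_3, e_1] = λ_2 e_2`, `[e_1, e_2] = λ_3 e_3`. -/
structure IsMilnorFrame {G : Type*} [TopologicalSpace G] [ChartedSpace E3 G] [Group G]
    (h : MetricField (𝓡 3) G) (e : Fin 3 → GroupLieAlgebra (𝓡 3) G) (lam : Fin 3 → ℝ) : Prop where
  orthonormal : ∀ i j, h 1 (e i) (e j) = if i = j then 1 else 0
  bracket_12 : ⁅e 1, e 2⁆ = lam 0 • e 0
  bracket_20 : ⁅e 2, e 0⁆ = lam 1 • e 1
  bracket_01 : ⁅e 0, e 1⁆ = lam 2 • e 2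

/-- Milnor's sign normalisation of the structure constants: the signs of `(λ_1, λ_2, λ_3)` are one
of `(0,0,0)`, `(+,0,0)`, `(+,0,-)`, `(+,+,0)`, `(+,+,-)`, `(+,+,+)`, and in the last two cases the
positive ones are listed in decreasing order. -/
def IsNormalizedSigns (lam : Fin 3 → ℝ) : Prop :=
  (lam 0 = 0 ∧ lam 1 = 0 ∧ lam 2 = 0) ∨
  (0 < lam 0 ∧ lam 1 = 0 ∧ lam 2 = 0) ∨
  (0 < lam 0 ∧ lam 1 = 0 ∧ lam 2 < 0) ∨
  (0 < lam 0 ∧ 0 < lam 1 ∧ lam 2 = 0) ∨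
  (lam 1 ≤ lam 0 ∧ 0 < lam 1 ∧ lam 2 < 0) ∨
  (lam 1 ≤ lam 0 ∧ lam 2 ≤ lam 1 ∧ 0 < lam 2)

/-- The vector with coordinates `v` in the Milnor frame is `± e_k`. -/
def IsPlusMinus (v : Fin 3 → ℝ) (k : Fin 3) : Prop := v = Pi.single k 1 ∨ v = -Pi.single k 1

/-- The list of cases; `v` are the coordinates of the unit vector field `V₂` in the frame. -/
def UnimodularCases (J : Set ℝ) (f : ℝ → ℝ) (lam : Fin 3 → ℝ) (ε : ℝ) (v : Fin 3 → ℝ) : Prop :=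
  -- case 1
  (lam 0 = 0 ∧ lam 1 = 0 ∧ lam 2 = 0 ∧ ε = 0 ∧
    ∃ α β : ℝ, ∀ t ∈ J, 0 < α * t + β ∧ f t = (α * t + β) ^ (1 / 3 : ℝ)) ∨
  -- case 2
  (0 < lam 0 ∧ lam 1 = 0 ∧ lam 2 = 0 ∧ ε = 2 * milnorMu lam 0 ^ 2) ∨
  -- case 3
  (0 < lam 0 ∧ lam 1 = 0 ∧ lam 2 < 0 ∧
    ((ε = milnorMu lam 0 ^ 2 + milnorMu lam 1 ^ 2 ∧ v 1 = 0) ∨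
      (ε = 2 * milnorMu lam 0 ^ 2 ∧ IsPlusMinus v 1))) ∨
  -- case 4
  (0 < lam 0 ∧ 0 < lam 1 ∧ lam 2 = 0 ∧
    ((ε = milnorMu lam 0 ^ 2 + milnorMu lam 2 ^ 2 ∧ v 2 = 0) ∨
      (ε = 2 * milnorMu lam 0 ^ 2 ∧ IsPlusMinus v 2))) ∨
  -- case 5
  (lam 0 = lam 1 ∧ 0 < lam 1 ∧ lam 2 < 0 ∧
    ((ε = milnorMu lam 0 ^ 2 + milnorMu lam 2 ^ 2 ∧ v 2 = 0) ∨
      (ε = 2 * milnorMu lam 0 ^ 2 ∧ IsPlusMinus v 2))) ∨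
  -- case 6
  (((lam 1 < lam 0 ∧ 0 < lam 1 ∧ lam 2 < 0) ∨ (lam 1 < lam 0 ∧ lam 2 < lam 1 ∧ 0 < lam 2)) ∧
    ∃ i j k : Fin 3, i ≠ j ∧ j ≠ k ∧ i ≠ k ∧
      ε = milnorMu lam i ^ 2 + milnorMu lam j ^ 2 ∧ IsPlusMinus v k) ∨
  -- case 7
  (lam 0 = lam 1 ∧ lam 1 = lam 2 ∧ 0 < lam 2 ∧ ε = 2 * milnorMu lam 0 ^ 2) ∨
  -- case 8
  (lam 1 < lam 0 ∧ lam 1 = lam 2 ∧ 0 < lam 2 ∧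
    ((ε = milnorMu lam 0 ^ 2 + milnorMu lam 1 ^ 2 ∧ v 0 = 0) ∨
      (ε = 2 * milnorMu lam 1 ^ 2 ∧ IsPlusMinus v 0))) ∨
  -- case 9
  (lam 0 = lam 1 ∧ lam 2 < lam 1 ∧ 0 < lam 2 ∧
    ((ε = milnorMu lam 0 ^ 2 + milnorMu lam 2 ^ 2 ∧ v 2 = 0) ∨
      (ε = 2 * milnorMu lam 0 ^ 2 ∧ IsPlusMinus v 2)))

end Milnor

end

open scoped Manifold ContDiff
open Bundle MeasureTheory

set_option linter.unusedSectionVars false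

noncomputable section

section FlatFrame

open Module VectorField
open scoped TensorProduct

variable {E : Type*} [NormedAddCommGroup E] [NormedSpace ℝ E]
  {ι : Type*} [Fintype ι] [DecidableEq ι]

theorem Module.Basis.det_update_eq (b B : Basis ι ℝ E) (i : ι) (w : E) :
    b.det (Function.update B i w) = B.repr w i * b.det B := by
  conv_lhs => rw [← B.sum_repr w, AlternatingMap.map_update_sum]
  rw [Finset.sum_eq_single i]
  · rw [AlternatingMap.map_update_smul, Function.update_eq_self, smul_eq_mul]
  · intro j _ hji
    rw [AlternatingMap.map_update_smul, AlternatingMap.map_update_self _ _ (Ne.symm hji), smul_zero]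
  · simp

variable [FiniteDimensional ℝ E]

theorem Module.Basis.hasFDerivAt_det (b : Basis ι ℝ E) {X : ι → E → E} {y : E}
    (hX : ∀ i, DifferentiableAt ℝ (X i) y) :
    ∃ D : E →L[ℝ] ℝ, HasFDerivAt (fun z => b.det (fun i => X i z)) D y ∧
      ∀ v, D v = ∑ i, b.det (Function.update (fun j => X j y) i (fderiv ℝ (X i) y v)) := by
  let m : ContinuousMultilinearMap ℝ (fun _ : ι => E) ℝ :=
    { b.det.toMultilinearMap with
      cont := by
        change Continuous fun v : ι → E => b.det v
        simp only [Basis.det_apply]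
        refine Continuous.matrix_det (continuous_matrix fun i j => ?_)
        simp only [Basis.toMatrix_apply]
        exact (LinearMap.continuous_of_finiteDimensional (b.coord i)).comp (continuous_apply j) }
  have := HasFDerivAt.multilinear_comp (f := m) (g := X) (fun i => (hX i).hasFDerivAt)
  refine ⟨_, this, fun v => ?_⟩
  simp
  rfl

/-- The flux of the density of a frame along a vector field of the frame. -/
theorem fderiv_frame_det (b : Basis ι ℝ E) {X : ι → E → E} {y : E} {c : ι → ι → ι → ℝ}
    (hX : ∀ i, DifferentiableAt ℝ (X i) y)
    (hbr : ∀ i j, lieBracket ℝ (X i) (X j) y = ∑ d, c i j d • X d y)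
    (hdet : b.det (fun i => X i y) ≠ 0) (a : ι) :
    fderiv ℝ (fun z => b.det (fun i => X i z)) y (X a y) =
      b.det (fun i => X i y) *
        (LinearMap.trace ℝ E (fderiv ℝ (X a) y : E →ₗ[ℝ] E) + ∑ i, c a i i) := by
  obtain ⟨D, hD, hDv⟩ := b.hasFDerivAt_det hX
  obtain ⟨hli, hsp⟩ := (Basis.is_basis_iff_det b (v := fun i => X i y)).2 (isUnit_iff_ne_zero.2 hdet)
  let B : Basis ι ℝ E := Basis.mk hli hsp.ge
  have hB : (B : ι → E) = fun i => X i y := Basis.coe_mk _ _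
  have hBi : ∀ i, B i = X i y := fun i => congrFun hB i
  rw [hD.fderiv, hDv, ← hB, LinearMap.trace_eq_matrix_trace ℝ B, Matrix.trace,
    ← Finset.sum_add_distrib, Finset.mul_sum]
  refine Finset.sum_congr rfl fun i _ => ?_
  have h1 : fderiv ℝ (X i) y (X a y) = fderiv ℝ (X a) y (X i y) + ∑ d, c a i d • X d y := by
    rw [← hbr, lieBracket]; abel
  rw [h1, b.det_update_eq, mul_comm]
  congr 1
  rw [Matrix.diag_apply, LinearMap.toMatrix_apply, map_add, Finsupp.add_apply, hBi i]
  congr 1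
  simp only [← hBi]
  simp [Finsupp.single_apply]

theorem trace_smulRight_apply (f : E →L[ℝ] ℝ) (x : E) :
    LinearMap.trace ℝ E (f.smulRight x : E →L[ℝ] E) = f x := by
  have h : ((f.smulRight x : E →L[ℝ] E) : E →ₗ[ℝ] E) =
      dualTensorHom ℝ E E ((f : E →ₗ[ℝ] ℝ) ⊗ₜ[ℝ] x) := by
    ext v; simp [dualTensorHom_apply]
  rw [h, LinearMap.trace_eq_contract_apply, contractLeft_apply]
  rfl

theorem integral_trace_fderiv_eq_zero [MeasurableSpace E] [BorelSpace E] (μ : Measure E)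
    [μ.IsAddHaarMeasure] {Z : E → E} (hZ : ContDiff ℝ 1 Z) (hc : HasCompactSupport Z) :
    ∫ y, LinearMap.trace ℝ E (fderiv ℝ Z y : E →ₗ[ℝ] E) ∂μ = 0 := by
  let b := Module.finBasis ℝ E
  have hcf : Continuous (fderiv ℝ Z) := hZ.continuous_fderiv one_ne_zero
  have hcs : HasCompactSupport (fderiv ℝ Z) := hc.fderiv ℝ
  let l : Fin (finrank ℝ E) → E →L[ℝ] ℝ := fun i => (b.coord i).toContinuousLinearMap
  have key : ∀ i, Integrable (fun y => l i (fderiv ℝ Z y (b i))) μ ∧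
      ∫ y, l i (fderiv ℝ Z y (b i)) ∂μ = 0 := by
    intro i
    have hint : Integrable (fun y => fderiv ℝ Z y (b i)) μ :=
      (hcf.clm_apply continuous_const).integrable_of_hasCompactSupport
        (hcs.comp_left (g := fun A : E →L[ℝ] E => A (b i)) (by simp))
    refine ⟨(l i).integrable_comp hint, ?_⟩
    rw [(l i).integral_comp_comm hint]
    have := integral_smul_fderiv_eq_neg_fderiv_smul_of_integrable (𝕜 := ℝ) (μ := μ)
      (f := fun _ : E => (1 : ℝ)) (g := Z) (v := b i) (by simp)
      (by simpa using hint) (by simpa using hZ.continuous.integrable_of_hasCompactSupport hc)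
      (by simp) (fun x _ => hZ.differentiable one_ne_zero x)
    simp at this
    rw [this, map_zero]
  have h2 : ∀ y, LinearMap.trace ℝ E (fderiv ℝ Z y : E →ₗ[ℝ] E) =
      ∑ i, l i (fderiv ℝ Z y (b i)) := by
    intro y
    rw [LinearMap.trace_eq_matrix_trace ℝ b, Matrix.trace]
    exact Finset.sum_congr rfl fun i _ => by
      rw [Matrix.diag_apply, LinearMap.toMatrix_apply]; rfl
  simp_rw [h2]
  rw [integral_finsetSum _ fun i _ => (key i).1]
  exact Finset.sum_eq_zero fun i _ => (key i).2

theorem integral_frame_divergence [MeasurableSpace E] [BorelSpace E] (μ : Measure E)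
    [μ.IsAddHaarMeasure] (b : Basis ι ℝ E) {U K : Set E} (hU : IsOpen U) (hK : IsCompact K)
    (hKU : K ⊆ U) {X : ι → E → E} (hX : ∀ i, ContDiffOn ℝ 1 (X i) U) {c : E → ι → ι → ι → ℝ}
    (hbr : ∀ y ∈ U, ∀ i j, lieBracket ℝ (X i) (X j) y = ∑ d, c y i j d • X d y)
    (hdet : ∀ y ∈ U, b.det (fun i => X i y) ≠ 0) {u : E → ℝ} (hu : ContDiffOn ℝ 1 u U)
    (hu0 : ∀ y ∈ U \ K, u y = 0) (a : ι) :
    ∫ y in K, (fderiv ℝ u y (X a y) - u y * ∑ i, c y a i i) *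
      |b.det (fun i => X i y)|⁻¹ ∂μ = 0 := by
  set δ : E → ℝ := fun z => b.det (fun i => X i z) with hδ
  let ρ : E → ℝ := fun z => |δ z|⁻¹
  have hXd : ∀ y ∈ U, ∀ i, ContDiffAt ℝ 1 (X i) y := fun y hy i => (hX i).contDiffAt (hU.mem_nhds hy)
  have hδc : ContDiffOn ℝ 1 δ U := by
    simp only [hδ, Basis.det_apply, Matrix.det_apply]
    refine ContDiffOn.sum fun σ _ => ContDiffOn.const_smul _ (contDiffOn_prod fun i _ => ?_)
    exact (b.coord (σ i)).toContinuousLinearMap.contDiff.comp_contDiffOn (hX i)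
  have hρc : ContDiffOn ℝ 1 ρ U := fun y hy =>
    (ContDiffAt.inv (f := fun z => |δ z|)
      (ContDiffAt.comp (g := fun r : ℝ => |r|) y (contDiffAt_abs (hdet y hy))
        (hδc.contDiffAt (hU.mem_nhds hy))) (abs_ne_zero.2 (hdet y hy))).contDiffWithinAt
  have hρd : ∀ y ∈ U, fderiv ℝ ρ y (X a y) = - ρ y *
      (LinearMap.trace ℝ E (fderiv ℝ (X a) y : E →ₗ[ℝ] E) + ∑ i, c y a i i) := by
    intro y hy
    have h1 := fderiv_frame_det b (fun i => (hXd y hy i).differentiableAt one_ne_zero)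
      (hbr y hy) (hdet y hy) a
    have hdd : DifferentiableAt ℝ δ y :=
      (hδc.contDiffAt (hU.mem_nhds hy)).differentiableAt one_ne_zero
    have hne : δ y ≠ 0 := hdet y hy
    have h1' : fderiv ℝ δ y (X a y) / δ y =
        LinearMap.trace ℝ E (fderiv ℝ (X a) y : E →ₗ[ℝ] E) + ∑ i, c y a i i := by
      rw [h1]; exact mul_div_cancel_left₀ _ hne
    have aux : ∀ s : ℝ, (∀ᶠ z in nhds y, |δ z| = s * δ z) → s ≠ 0 →
        fderiv ℝ ρ y (X a y) = - ρ y * (fderiv ℝ δ y (X a y) / δ y) := by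
      intro s hs hs0
      have e1 : ρ =ᶠ[nhds y] fun z => (s * δ z)⁻¹ := hs.mono fun z hz => by simp only [ρ, hz]
      have e2 : HasFDerivAt (fun z => (s * δ z)⁻¹) _ y :=
        (hasFDerivAt_inv (mul_ne_zero hs0 hne)).comp y (hdd.hasFDerivAt.const_mul s)
      rw [e1.fderiv_eq, e2.fderiv, e1.self_of_nhds]
      simp
      field_simp
    rcases lt_or_gt_of_ne hne with h | h
    · rw [aux (-1) ?_ (by norm_num), h1']
      · filter_upwards [hdd.continuousAt.eventually (gt_mem_nhds h)] with z hz
        rw [abs_of_neg hz]; ring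
    · rw [aux 1 ?_ (by norm_num), h1']
      · filter_upwards [hdd.continuousAt.eventually (lt_mem_nhds h)] with z hz
        rw [abs_of_pos hz]; ring
  let Z : E → E := U.indicator fun y => (u y * ρ y) • X a y
  have hZU : ∀ y ∈ U, Z =ᶠ[nhds y] fun y => (u y * ρ y) • X a y := fun y hy => by
    filter_upwards [hU.mem_nhds hy] with z hz
    exact Set.indicator_of_mem hz _
  have hZ0 : ∀ y ∉ K, Z y = 0 := fun y hy => by
    by_cases hyU : y ∈ U
    · simp [Z, Set.indicator_of_mem hyU, hu0 y ⟨hyU, hy⟩]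
    · exact Set.indicator_of_notMem hyU _
  have hZK : ∀ y ∉ K, Z =ᶠ[nhds y] fun _ => 0 := fun y hy => by
    filter_upwards [hK.isClosed.isOpen_compl.mem_nhds hy] with z hz
    exact hZ0 z hz
  have hZc : ContDiff ℝ 1 Z := by
    rw [contDiff_iff_contDiffAt]
    intro y
    by_cases hy : y ∈ U
    · exact ((((hu.mul hρc).smul (hX a)).contDiffAt (hU.mem_nhds hy))).congr_of_eventuallyEq
        (hZU y hy)
    · exact contDiffAt_const.congr_of_eventuallyEq (hZK y fun h => hy (hKU h))
  have hZs : HasCompactSupport Z := HasCompactSupport.intro hK hZ0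
  rw [← integral_trace_fderiv_eq_zero μ hZc hZs]
  rw [← setIntegral_eq_integral_of_forall_compl_eq_zero (s := K)
    (f := fun y => LinearMap.trace ℝ E (fderiv ℝ Z y : E →ₗ[ℝ] E))]
  · refine setIntegral_congr_fun hK.measurableSet fun y hy => ?_
    have hyU := hKU hy
    have du := (hu.contDiffAt (hU.mem_nhds hyU)).differentiableAt one_ne_zero
    have dρ := (hρc.contDiffAt (hU.mem_nhds hyU)).differentiableAt one_ne_zero
    have dX := (hXd y hyU a).differentiableAt one_ne_zero
    have e1 : fderiv ℝ Z y = (u y * ρ y) • fderiv ℝ (X a) y +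
        (u y • fderiv ℝ ρ y + ρ y • fderiv ℝ u y).smulRight (X a y) := by
      rw [(hZU y hyU).fderiv_eq]
      exact ((du.hasFDerivAt.mul dρ.hasFDerivAt).smul dX.hasFDerivAt).fderiv
    have e2 : LinearMap.trace ℝ E (fderiv ℝ Z y : E →ₗ[ℝ] E) =
        (u y * ρ y) * LinearMap.trace ℝ E (fderiv ℝ (X a) y : E →ₗ[ℝ] E) +
        (u y * fderiv ℝ ρ y (X a y) + ρ y * fderiv ℝ u y (X a y)) := by
      rw [e1]
      simp only [ContinuousLinearMap.toLinearMap_add, ContinuousLinearMap.toLinearMap_smul, map_add,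
        map_smul, smul_eq_mul]
      congr 1
      exact trace_smulRight_apply _ _
    change _ * ρ y = _
    rw [e2, hρd y hyU]
    ring
  · intro y hy
    rw [(hZK y hy).fderiv_eq]
    simp

end FlatFrame

section FrameCoefficients

open Module

variable {E : Type*} [NormedAddCommGroup E] [NormedSpace ℝ E]
  {ι : Type*} [Fintype ι] [DecidableEq ι]

theorem Module.Basis.contDiff_det [FiniteDimensional ℝ E] (b : Basis ι ℝ E) :
    ContDiff ℝ ∞ fun v : ι → E => b.det v := by
  simp only [Basis.det_apply, Matrix.det_apply]
  refine ContDiff.sum fun σ _ => ContDiff.const_smul _ (contDiff_prod fun i _ => ?_)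
  exact (b.coord (σ i)).toContinuousLinearMap.contDiff.comp (contDiff_apply ℝ E i)

/-- Cramer's rule: the `i`-th coordinate of `w` in the family `v`. -/
def cramerCoord (b : Basis ι ℝ E) (i : ι) (q : (ι → E) × E) : ℝ :=
  b.det (Function.update q.1 i q.2) / b.det q.1

theorem contDiffAt_cramerCoord [FiniteDimensional ℝ E] (b : Basis ι ℝ E) (i : ι)
    {q : (ι → E) × E} (hq : b.det q.1 ≠ 0) : ContDiffAt ℝ ∞ (cramerCoord b i) q := by
  refine ContDiffAt.div ?_ ?_ hq
  · refine (b.contDiff_det.comp (contDiff_pi.2 fun j => ?_)).contDiffAt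
    by_cases h : j = i
    · subst h; simpa using contDiff_snd
    · simpa [Function.update_of_ne h] using!
        (contDiff_apply ℝ E j).comp (contDiff_fst (E := ι → E) (F := E))
  · exact (b.contDiff_det.comp contDiff_fst).contDiffAt

theorem Module.Basis.repr_eq_cramerCoord (b B : Basis ι ℝ E) (i : ι) (w : E) :
    B.repr w i = cramerCoord b i (B, w) := by
  rw [cramerCoord, b.det_update_eq, mul_div_cancel_right₀]
  exact (b.isUnit_det B).ne_zero

variable [FiniteDimensional ℝ E]
  {H : Type*} [TopologicalSpace H] {I : ModelWithCorners ℝ E H}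
  {M : Type*} [TopologicalSpace M] [ChartedSpace H M] [IsManifold I ∞ M]

namespace IsLocalFrameOn

variable {F : ι → VField I M}

theorem coeff_frame (hF : IsLocalFrameOn I E ∞ F Set.univ) (p : M) (i j : ι) :
    hF.coeff i p (F j p) = if i = j then 1 else 0 := by
  rw [hF.coeff_apply_of_mem (Set.mem_univ p), ← hF.toBasisAt_coe (Set.mem_univ p) j,
    Basis.repr_self, Finsupp.single_apply]
  exact if_congr eq_comm rfl rfl

theorem sum_coeff (hF : IsLocalFrameOn I E ∞ F Set.univ) (p : M) (u : TangentSpace I p) :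
    u = ∑ i, hF.coeff i p u • F i p := by
  have := (hF.toBasisAt (Set.mem_univ p)).sum_repr u
  simp only [hF.toBasisAt_coe] at this
  conv_lhs => rw [← this]
  refine Finset.sum_congr rfl fun i _ => ?_
  rw [IsLocalFrameOn.coeff, dif_pos (Set.mem_univ p)]
  rfl

theorem coeff_eq_cramerCoord (hF : IsLocalFrameOn I E ∞ F Set.univ) (b : Basis ι ℝ E)
    {p₀ p : M} (hp : p ∈ (trivializationAt E (TangentSpace I) p₀).baseSet)
    (Y : VField I M) (i : ι) :
    b.det (fun j => (trivializationAt E (TangentSpace I) p₀ ⟨p, F j p⟩).2) ≠ 0 ∧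
    hF.coeff i p (Y p) = cramerCoord b i
      (fun j => (trivializationAt E (TangentSpace I) p₀ ⟨p, F j p⟩).2,
        (trivializationAt E (TangentSpace I) p₀ ⟨p, Y p⟩).2) := by
  let e := trivializationAt E (TangentSpace I) p₀
  let B : Basis ι ℝ E := (hF.toBasisAt (Set.mem_univ p)).map (e.linearEquivAt ℝ p hp)
  have hB : (B : ι → E) = fun j => (e ⟨p, F j p⟩).2 := by
    ext j
    simp [B]
  refine ⟨?_, ?_⟩
  · change b.det (fun j => (e ⟨p, F j p⟩).2) ≠ 0
    rw [← hB]
    exact (b.isUnit_det B).ne_zero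
  · change _ = cramerCoord b i ((fun j => (e ⟨p, F j p⟩).2), (e ⟨p, Y p⟩).2)
    rw [← hB, ← b.repr_eq_cramerCoord, hF.coeff_apply_of_mem (Set.mem_univ p)]
    change _ = (hF.toBasisAt (Set.mem_univ p)).repr
      ((e.linearEquivAt ℝ p hp).symm (e.linearEquivAt ℝ p hp (Y p))) i
    rw [LinearEquiv.symm_apply_apply]

/-- A basis of the model space indexed by a frame. -/
theorem exists_modelBasis (hF : IsLocalFrameOn I E ∞ F Set.univ) (p : M) :
    Nonempty (Basis ι ℝ E) :=
  ⟨(hF.toBasisAt (Set.mem_univ p)).map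
    ((trivializationAt E (TangentSpace I) p).linearEquivAt ℝ p
      (FiberBundle.mem_baseSet_trivializationAt' p))⟩

theorem contMDiffAt_coeff (hF : IsLocalFrameOn I E ∞ F Set.univ) {Y : VField I M} {p₀ : M}
    (hY : ContMDiffAt I I.tangent ∞ (fun p : M => (⟨p, Y p⟩ : TangentBundle I M)) p₀) (i : ι) :
    ContMDiffAt I 𝓘(ℝ, ℝ) ∞ (fun p => hF.coeff i p (Y p)) p₀ := by
  obtain ⟨b⟩ := hF.exists_modelBasis p₀
  let e := trivializationAt E (TangentSpace I) p₀
  have hp₀ : p₀ ∈ e.baseSet := FiberBundle.mem_baseSet_trivializationAt' p₀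
  have hF' : ∀ j, ContMDiffAt I 𝓘(ℝ, E) ∞ (fun p => (e ⟨p, F j p⟩).2) p₀ := fun j =>
    (e.contMDiffAt_section_iff hp₀).1 ((hF.contMDiffOn j).contMDiffAt Filter.univ_mem)
  have hY' : ContMDiffAt I 𝓘(ℝ, E) ∞ (fun p => (e ⟨p, Y p⟩).2) p₀ :=
    (e.contMDiffAt_section_iff hp₀).1 hY
  have h1 : ContMDiffAt I 𝓘(ℝ, (ι → E) × E) ∞
      (fun p => ((fun j => (e ⟨p, F j p⟩).2), (e ⟨p, Y p⟩).2)) p₀ :=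
    (contMDiffAt_pi_space.2 hF').prodMk_space hY'
  have h2 := (contDiffAt_cramerCoord b i
    (hF.coeff_eq_cramerCoord b hp₀ Y i).1).contMDiffAt.comp p₀ h1
  refine h2.congr_of_eventuallyEq ?_
  filter_upwards [e.open_baseSet.mem_nhds hp₀] with p hp
  exact (hF.coeff_eq_cramerCoord b hp Y i).2

theorem mdifferentiableAt_coeff (hF : IsLocalFrameOn I E ∞ F Set.univ) {Y : VField I M} {p₀ : M}
    (hY : MDifferentiableAt I I.tangent (fun p : M => (⟨p, Y p⟩ : TangentBundle I M)) p₀)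
    (i : ι) : MDifferentiableAt I 𝓘(ℝ, ℝ) (fun p => hF.coeff i p (Y p)) p₀ := by
  obtain ⟨b⟩ := hF.exists_modelBasis p₀
  let e := trivializationAt E (TangentSpace I) p₀
  have hp₀ : p₀ ∈ e.baseSet := FiberBundle.mem_baseSet_trivializationAt' p₀
  have hF' : ∀ j, ContMDiffAt I 𝓘(ℝ, E) ∞ (fun p => (e ⟨p, F j p⟩).2) p₀ := fun j =>
    (e.contMDiffAt_section_iff hp₀).1 ((hF.contMDiffOn j).contMDiffAt Filter.univ_mem)
  have hY' : MDifferentiableAt I 𝓘(ℝ, E) (fun p => (e ⟨p, Y p⟩).2) p₀ :=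
    (e.mdifferentiableAt_section_iff I Y hp₀).1 hY
  have h1 : MDifferentiableAt I 𝓘(ℝ, (ι → E) × E)
      (fun p => ((fun j => (e ⟨p, F j p⟩).2), (e ⟨p, Y p⟩).2)) p₀ :=
    ((contMDiffAt_pi_space.2 hF').mdifferentiableAt (by simp)).prodMk_space hY'
  have h2 := ((contDiffAt_cramerCoord b i
    (hF.coeff_eq_cramerCoord b hp₀ Y i).1).contMDiffAt.mdifferentiableAt (by simp)).comp p₀ h1
  refine h2.congr_of_eventuallyEq ?_
  filter_upwards [e.open_baseSet.mem_nhds hp₀] with p hp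
  exact (hF.coeff_eq_cramerCoord b hp Y i).2

end IsLocalFrameOn

end FrameCoefficients

section FrameConnection

open Module VectorField

variable {E : Type*} [NormedAddCommGroup E] [NormedSpace ℝ E]
  {ι : Type*} [Fintype ι] [DecidableEq ι] [FiniteDimensional ℝ E]
  {H : Type*} [TopologicalSpace H] {I : ModelWithCorners ℝ E H}
  {M : Type*} [TopologicalSpace M] [ChartedSpace H M] [IsManifold I ∞ M]

theorem mvfderiv_fun_sum {κ : Type*} (s : Finset κ) {u : κ → M → ℝ} {p : M}
    (hu : ∀ i ∈ s, MDifferentiableAt I 𝓘(ℝ, ℝ) (u i) p) :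
    MDifferentiableAt I 𝓘(ℝ, ℝ) (fun q => ∑ i ∈ s, u i q) p ∧
    mvfderiv I (fun q => ∑ i ∈ s, u i q) p = ∑ i ∈ s, mvfderiv I (u i) p := by
  classical
  induction s using Finset.induction_on with
  | empty => exact ⟨by simpa using mdifferentiableAt_const, by simpa using mvfderiv_const (0 : ℝ)⟩
  | insert a s ha ih =>
    obtain ⟨h1, h2⟩ := ih fun i hi => hu i (Finset.mem_insert_of_mem hi)
    have h3 := hu a (Finset.mem_insert_self a s)
    simp only [Finset.sum_insert ha]
    exact ⟨h3.add h1, by rw [mvfderiv_fun_add h3 h1, h2]⟩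

theorem IsSmoothVField.mdifferentiableAt {Y : VField I M} (hY : IsSmoothVField Y) (p : M) :
    MDifferentiableAt I I.tangent (fun q : M => (⟨q, Y q⟩ : TangentBundle I M)) p :=
  hY.contMDiffAt.mdifferentiableAt (by simp)

/-- `F` is a smooth global frame, orthonormal for `g`, with structure functions `c`. -/
structure IsOrthonormalFrame (g : MetricField I M) (F : ι → VField I M)
    (c : ι → ι → ι → M → ℝ) : Prop where
  frame : IsLocalFrameOn I E ∞ F Set.univ
  metric : ∀ (p : M) (x y : ι → ℝ), g p (∑ i, x i • F i p) (∑ i, y i • F i p) = ∑ i, x i * y i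
  bracket : ∀ i j p, mlieBracket I (F i) (F j) p = ∑ d, c i j d p • F d p
  smooth : ∀ i j d, ContMDiff I 𝓘(ℝ, ℝ) ∞ (c i j d)

/-- The Koszul formula in an orthonormal frame with structure functions `c`. -/
def koszul (c : ι → ι → ι → M → ℝ) (a b d : ι) (p : M) : ℝ :=
  (c a b d p - c b d a p + c d a b p) / 2

namespace IsOrthonormalFrame

variable {g : MetricField I M} {F : ι → VField I M} {c : ι → ι → ι → M → ℝ}

theorem metric_eq (h : IsOrthonormalFrame g F c) (p : M) (u w : TangentSpace I p) :
    g p u w = ∑ i, h.frame.coeff i p u * h.frame.coeff i p w := by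
  conv_lhs => rw [h.frame.sum_coeff p u, h.frame.sum_coeff p w]
  exact h.metric p _ _

theorem coeff_sum (h : IsOrthonormalFrame g F c) (p : M) (x : ι → ℝ) (i : ι) :
    h.frame.coeff i p (∑ j, x j • F j p) = x i := by
  simp only [map_sum, map_smul, h.frame.coeff_frame, smul_eq_mul]
  simp

theorem eq_of_coeff (h : IsOrthonormalFrame g F c) {p : M} {u w : TangentSpace I p}
    (huw : ∀ i, h.frame.coeff i p u = h.frame.coeff i p w) : u = w := by
  rw [h.frame.sum_coeff p u, h.frame.sum_coeff p w]
  simp only [huw]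

theorem mdifferentiableAt (h : IsOrthonormalFrame g F c) (i : ι) (p : M) :
    MDifferentiableAt I I.tangent (fun q : M => (⟨q, F i q⟩ : TangentBundle I M)) p :=
  ((h.frame.contMDiffOn i).contMDiffAt Filter.univ_mem).mdifferentiableAt (by simp)

theorem coeff_bracket (h : IsOrthonormalFrame g F c) (i j d : ι) (p : M) :
    h.frame.coeff d p (mlieBracket I (F i) (F j) p) = c i j d p := by
  rw [h.bracket, h.coeff_sum p (fun d => c i j d p)]

theorem structure_antisymm (h : IsOrthonormalFrame g F c) (i j d : ι) (p : M) :
    c i j d p = - c j i d p := by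
  rw [← h.coeff_bracket, ← h.coeff_bracket, mlieBracket_swap_apply, map_neg]

theorem koszul_antisymm (h : IsOrthonormalFrame g F c) (a b d : ι) (p : M) :
    koszul c a b d p = - koszul c a d b p := by
  have h1 := h.structure_antisymm d a b p
  have h2 := h.structure_antisymm b d a p
  have h3 := h.structure_antisymm a b d p
  simp only [koszul]
  linarith

theorem koszul_sub (h : IsOrthonormalFrame g F c) (a b d : ι) (p : M) :
    koszul c a b d p - koszul c b a d p = c a b d p := by
  have h1 := h.structure_antisymm d a b p
  have h2 := h.structure_antisymm b d a p
  have h3 := h.structure_antisymm a b d p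
  simp only [koszul]
  linarith

/-- The coefficient `h.frame.coeff i p` as a continuous linear form. -/
def coframe (h : IsOrthonormalFrame g F c) (i : ι) (p : M) : TangentSpace I p →L[ℝ] ℝ :=
  LinearMap.toContinuousLinearMap (𝕜 := ℝ) (E := E) (F' := ℝ) (h.frame.coeff i p)

theorem coframe_apply (h : IsOrthonormalFrame g F c) (i : ι) (p : M) (u : TangentSpace I p) :
    h.coframe i p u = h.frame.coeff i p u := rfl

/-- The components of the covariant derivative in the frame. -/
def nablaCoeff (h : IsOrthonormalFrame g F c) (Y : VField I M) (d : ι) (p : M) :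
    TangentSpace I p →L[ℝ] ℝ :=
  mvfderiv I (fun q => h.frame.coeff d q (Y q)) p +
    ∑ a, (∑ b, h.frame.coeff b p (Y p) * koszul c a b d p) • h.coframe a p

theorem nablaCoeff_apply (h : IsOrthonormalFrame g F c) (Y : VField I M) (d : ι) (p : M)
    (v : TangentSpace I p) : h.nablaCoeff Y d p v =
      mvfderiv I (fun q => h.frame.coeff d q (Y q)) p v +
        ∑ a, (∑ b, h.frame.coeff b p (Y p) * koszul c a b d p) * h.frame.coeff a p v := by
  simp only [nablaCoeff, add_apply, sum_apply,
    smul_apply, smul_eq_mul, coframe_apply]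

/-- The Levi-Civita connection of an orthonormal frame. -/
def connection (h : IsOrthonormalFrame g F c) :
    CovariantDerivative I E (fun p : M => TangentSpace I p) where
  toFun Y p := ∑ d, (h.nablaCoeff Y d p).smulRight (F d p)
  isCovariantDerivativeOnUniv :=
    { add := fun {Y Z p} hY hZ _ => by
        rw [← Finset.sum_add_distrib]
        refine Finset.sum_congr rfl fun d _ => ?_
        ext1 v
        simp only [add_apply, ContinuousLinearMap.smulRight_apply]
        rw [← add_smul]
        congr 1
        simp only [nablaCoeff_apply, Pi.add_apply, map_add]
        rw [mvfderiv_fun_add (h.frame.mdifferentiableAt_coeff hY d)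
          (h.frame.mdifferentiableAt_coeff hZ d)]
        simp only [add_apply, add_mul, Finset.sum_add_distrib]
        ring
      leibniz := fun {Y u p} hY hu _ => by
        ext1 v
        simp only [sum_apply, add_apply,
          ContinuousLinearMap.smulRight_apply, smul_apply]
        conv_rhs => rw [h.frame.sum_coeff p (Y p), Finset.smul_sum, Finset.smul_sum,
          ← Finset.sum_add_distrib]
        refine Finset.sum_congr rfl fun d _ => ?_
        rw [smul_smul, smul_smul, ← add_smul]
        congr 1
        simp only [nablaCoeff_apply, Pi.smul_apply', map_smul, smul_eq_mul]
        rw [mvfderiv_fun_mul hu (h.frame.mdifferentiableAt_coeff hY d)]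
        simp only [add_apply, smul_apply, smul_eq_mul,
          mul_assoc, ← Finset.mul_sum]
        ring }

theorem coeff_connection (h : IsOrthonormalFrame g F c) (Y : VField I M) (p : M)
    (v : TangentSpace I p) (d : ι) :
    h.frame.coeff d p (h.connection Y p v) = h.nablaCoeff Y d p v := by
  have : h.connection Y p v = ∑ d, h.nablaCoeff Y d p v • F d p := by
    change (∑ d, (h.nablaCoeff Y d p).smulRight (F d p) : TangentSpace I p →L[ℝ] TangentSpace I p)
      v = _
    simp only [sum_apply, ContinuousLinearMap.smulRight_apply]
  rw [this, h.coeff_sum p (fun d => h.nablaCoeff Y d p v)]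

theorem nablaCoeff_frame (h : IsOrthonormalFrame g F c) (a b d : ι) (p : M) :
    h.nablaCoeff (F b) d p (F a p) = koszul c a b d p := by
  rw [nablaCoeff_apply]
  have : (fun q => h.frame.coeff d q (F b q)) = fun _ => if d = b then (1 : ℝ) else 0 := by
    ext q; rw [h.frame.coeff_frame]
  rw [this, mvfderiv_const]
  simp [h.frame.coeff_frame]

theorem nablaCoeff_apply_frame (h : IsOrthonormalFrame g F c) (Y : VField I M) (a d : ι) (p : M) :
    h.nablaCoeff Y d p (F a p) = mvfderiv I (fun q => h.frame.coeff d q (Y q)) p (F a p) +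
      ∑ b, h.frame.coeff b p (Y p) * koszul c a b d p := by
  rw [nablaCoeff_apply]
  simp [h.frame.coeff_frame]

theorem isLeviCivita_connection (h : IsOrthonormalFrame g F c) :
    IsLeviCivita g h.connection where
  torsion_free := by
    ext p u v
    rw [h.frame.sum_coeff p u, h.frame.sum_coeff p v]
    simp only [map_sum, map_smul, sum_apply, smul_apply]
    refine (Finset.sum_eq_zero fun i _ => ?_).trans (by simp)
    rw [Finset.sum_eq_zero, smul_zero]
    intro j _
    rw [CovariantDerivative.torsion_apply _ (h.mdifferentiableAt _ p) (h.mdifferentiableAt _ p),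
      h.eq_of_coeff (u := _ - _ - _) (w := 0), smul_zero]
    intro d
    rw [map_sub, map_sub, h.coeff_connection, h.coeff_connection, h.nablaCoeff_frame,
      h.nablaCoeff_frame, h.coeff_bracket, h.koszul_sub, sub_self, map_zero]
  metric p Y Z hY hZ v := by
    have hy := h.frame.mdifferentiableAt_coeff hY
    have hz := h.frame.mdifferentiableAt_coeff hZ
    simp only [h.metric_eq, h.coeff_connection, nablaCoeff_apply]
    rw [(mvfderiv_fun_sum (u := fun i q => h.frame.coeff i q (Y q) * h.frame.coeff i q (Z q))
      Finset.univ fun i _ => (hy i).mul (hz i)).2]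
    simp only [sum_apply, mvfderiv_fun_mul (hy _) (hz _), add_apply, smul_apply, smul_eq_mul]
    have key : ∑ i, (∑ a, (∑ b, h.frame.coeff b p (Y p) * koszul c a b i p) *
        h.frame.coeff a p v) * h.frame.coeff i p (Z p) +
        ∑ i, h.frame.coeff i p (Y p) * (∑ a, (∑ b, h.frame.coeff b p (Z p) * koszul c a b i p) *
        h.frame.coeff a p v) = 0 := by
      simp only [Finset.sum_mul, Finset.mul_sum]
      conv_lhs =>
        arg 2
        rw [Finset.sum_comm]
        enter [2, a]
        rw [Finset.sum_comm]
      conv_lhs => arg 1; rw [Finset.sum_comm]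
      rw [← Finset.sum_add_distrib]
      refine Finset.sum_eq_zero fun a _ => ?_
      rw [← Finset.sum_add_distrib]
      refine Finset.sum_eq_zero fun i _ => ?_
      rw [← Finset.sum_add_distrib]
      refine Finset.sum_eq_zero fun b _ => ?_
      rw [h.koszul_antisymm a b i p]
      ring
    simp only [add_mul, mul_add, Finset.sum_add_distrib] at key ⊢
    have e : ∀ f : ι → ℝ, ∑ i, h.frame.coeff i p (Z p) * f i = ∑ i, f i * h.frame.coeff i p (Z p) :=
      fun f => Finset.sum_congr rfl fun i _ => mul_comm _ _
    rw [e]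
    linarith

/-- The Levi-Civita connection in an orthonormal frame. -/
theorem coeff_leviCivita_frame (h : IsOrthonormalFrame g F c)
    {nabla : CovariantDerivative I E (fun p : M => TangentSpace I p)} (hn : IsLeviCivita g nabla)
    (a b d : ι) (p : M) :
    h.frame.coeff d p (nabla (F b) p (F a p)) = koszul c a b d p := by
  have anti : ∀ a b d : ι, h.frame.coeff d p (nabla (F b) p (F a p)) =
      - h.frame.coeff b p (nabla (F d) p (F a p)) := by
    intro a b d
    have := hn.metric p (F b) (F d) (h.mdifferentiableAt b p) (h.mdifferentiableAt d p) (F a p)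
    simp only [h.metric_eq, h.frame.coeff_frame] at this
    rw [mvfderiv_const] at this
    simp at this
    linarith
  have tors : ∀ a b d : ι, h.frame.coeff d p (nabla (F b) p (F a p)) -
      h.frame.coeff d p (nabla (F a) p (F b p)) = c a b d p := by
    intro a b d
    rw [← h.coeff_bracket, ← (CovariantDerivative.torsion_eq_zero_iff nabla).1 hn.torsion_free
      (h.mdifferentiableAt a p) (h.mdifferentiableAt b p), map_sub]
  have t1 := tors a b d
  have t2 := tors b d a
  have t3 := tors d a b
  have a1 := anti a b d
  have a2 := anti b a d
  have a3 := anti d a b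
  simp only [koszul]
  linarith

theorem coeff_leviCivita (h : IsOrthonormalFrame g F c)
    {nabla : CovariantDerivative I E (fun p : M => TangentSpace I p)} (hn : IsLeviCivita g nabla)
    {Y : VField I M} {p : M}
    (hY : MDifferentiableAt I I.tangent (fun q : M => (⟨q, Y q⟩ : TangentBundle I M)) p)
    (v : TangentSpace I p) (d : ι) :
    h.frame.coeff d p (nabla Y p v) = h.nablaCoeff Y d p v := by
  let T : ι → VField I M := fun b => (fun q => h.frame.coeff b q (Y q)) • F b
  have hy := h.frame.mdifferentiableAt_coeff hY
  have hT : ∀ b, MDifferentiableAt I I.tangent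
      (fun q : M => (⟨q, T b q⟩ : TangentBundle I M)) p := fun b =>
    (hy b).smul_section (h.mdifferentiableAt b p)
  have hsum : ∀ s : Finset ι, MDifferentiableAt I I.tangent
      (fun q : M => (⟨q, (∑ b ∈ s, T b) q⟩ : TangentBundle I M)) p ∧
      nabla (∑ b ∈ s, T b) p = ∑ b ∈ s, nabla (T b) p := by
    intro s
    induction s using Finset.induction_on with
    | empty =>
      refine ⟨?_, by simp⟩
      simpa using! mdifferentiableAt_zeroSection ℝ (TangentSpace I : M → Type _)
    | insert a s ha ih =>
      rw [Finset.sum_insert ha, Finset.sum_insert ha]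
      exact ⟨mdifferentiableAt_add_section (hT a) ih.1, by
        rw [nabla.isCovariantDerivativeOnUniv.add (hT a) ih.1, ih.2]⟩
  have hYT : Y = ∑ b, T b := by
    ext1 q
    rw [Finset.sum_apply]
    exact h.frame.sum_coeff q (Y q)
  have e1 : nabla Y p = ∑ b, nabla (T b) p := by
    conv_lhs => rw [hYT]
    exact (hsum Finset.univ).2
  have e2 : ∀ b, nabla (T b) p = h.frame.coeff b p (Y p) • nabla (F b) p +
      (mvfderiv I (fun q => h.frame.coeff b q (Y q)) p).smulRight (F b p) := fun b =>
    nabla.isCovariantDerivativeOnUniv.leibniz (h.mdifferentiableAt b p) (hy b)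
  have e3 : ∀ b, h.frame.coeff d p (nabla (F b) p v) =
      ∑ a, h.frame.coeff a p v * koszul c a b d p := by
    intro b
    conv_lhs => rw [h.frame.sum_coeff p v]
    simp only [map_sum, map_smul, smul_eq_mul, h.coeff_leviCivita_frame hn]
  rw [e1, nablaCoeff_apply]
  simp only [e2, sum_apply, add_apply, smul_apply, ContinuousLinearMap.smulRight_apply, map_sum,
    map_add, map_smul, smul_eq_mul, e3, h.frame.coeff_frame, Finset.sum_add_distrib]
  rw [add_comm]
  congr 1
  · simp
  · simp only [Finset.mul_sum, Finset.sum_mul]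
    rw [Finset.sum_comm]
    exact Finset.sum_congr rfl fun a _ => Finset.sum_congr rfl fun b _ => by ring

end IsOrthonormalFrame

end FrameConnection

section GramLinearAlgebra

open Module

variable {W : Type*} [AddCommGroup W] [Module ℝ W] {ι κ : Type*} [Fintype ι] [Fintype κ]
  [DecidableEq ι] [DecidableEq κ]

theorem Module.Basis.gram_eq (B : Basis ι ℝ W) (b : κ → W) :
    (Matrix.of fun i j => ∑ a, B.repr (b i) a * B.repr (b j) a) =
      (B.toMatrix b).transpose * B.toMatrix b := by
  ext i j
  simp [Matrix.mul_apply, Basis.toMatrix_apply]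

theorem Module.Basis.sum_gram_inv (B : Basis ι ℝ W) (b : Basis κ ℝ W) (A : W →ₗ[ℝ] W) :
    ∑ i, ∑ j, (Matrix.of fun i j => ∑ a, B.repr (b i) a * B.repr (b j) a)⁻¹ i j *
      ∑ d, B.repr (A (b i)) d * B.repr (A (b j)) d = ∑ a, ∑ d, B.repr (A (B a)) d ^ 2 := by
  set T := B.toMatrix b
  set S := b.toMatrix B
  have hTS : T * S = 1 := B.toMatrix_mul_toMatrix_flip b
  have hST : S * T = 1 := b.toMatrix_mul_toMatrix_flip B
  have hinv : (Matrix.of fun i j => ∑ a, B.repr (b i) a * B.repr (b j) a)⁻¹ =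
      S * S.transpose := by
    rw [B.gram_eq]
    refine Matrix.inv_eq_right_inv ?_
    change T.transpose * T * (S * S.transpose) = 1
    rw [Matrix.mul_assoc, ← Matrix.mul_assoc T, hTS, Matrix.one_mul, ← Matrix.transpose_mul, hST,
      Matrix.transpose_one]
  rw [hinv]
  set N := LinearMap.toMatrix b B A
  have hN : ∀ i d, B.repr (A (b i)) d = N d i := fun i d => by simp [N, LinearMap.toMatrix_apply]
  have hNS : ∀ a d, B.repr (A (B a)) d = (N * S) d a := by
    intro a d
    conv_lhs => rw [← b.sum_repr (B a)]
    simp only [map_sum, map_smul, Finsupp.coe_finsetSum, Finset.sum_apply, Finsupp.smul_apply,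
      smul_eq_mul, Matrix.mul_apply, hN]
    exact Finset.sum_congr rfl fun i _ => by rw [mul_comm]; rfl
  simp only [hN, hNS]
  calc ∑ i, ∑ j, (S * S.transpose) i j * ∑ d, N d i * N d j
      = ∑ i, ∑ j, ∑ a, ∑ d, S i a * S j a * (N d i * N d j) := by
        refine Finset.sum_congr rfl fun i _ => Finset.sum_congr rfl fun j _ => ?_
        rw [Matrix.mul_apply, Finset.sum_mul_sum]
        rfl
    _ = ∑ a, ∑ d, ∑ i, ∑ j, S i a * S j a * (N d i * N d j) := by
        simp_rw [Finset.sum_comm (s := (Finset.univ : Finset κ)) (t := (Finset.univ : Finset ι))]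
    _ = _ := by
        refine Finset.sum_congr rfl fun a _ => Finset.sum_congr rfl fun d _ => ?_
        rw [Matrix.mul_apply, sq, Finset.sum_mul_sum]
        exact Finset.sum_congr rfl fun i _ => Finset.sum_congr rfl fun j _ => by ring

theorem Module.Basis.sqrt_det_gram (B : Basis ι ℝ W) (b : Basis κ ℝ W) (σ : κ ≃ ι) :
    √(Matrix.of fun i j => ∑ a, B.repr (b i) a * B.repr (b j) a).det =
      |(b.reindex σ).det B|⁻¹ := by
  have h1 : (Matrix.of fun i j => ∑ a, B.repr (b i) a * B.repr (b j) a) =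
      ((B.toMatrix (b.reindex σ)).transpose * B.toMatrix (b.reindex σ)).submatrix σ σ := by
    ext i j
    simp [Matrix.mul_apply, Basis.toMatrix_apply]
  rw [h1, Matrix.det_submatrix_equiv_self, Matrix.det_mul, Matrix.det_transpose, ← Basis.det_apply,
    Real.sqrt_mul_self_eq_abs]
  have h2 : B.det (b.reindex σ) * (b.reindex σ).det B = 1 := by
    rw [Basis.det_apply, Basis.det_apply, ← Matrix.det_mul, Basis.toMatrix_mul_toMatrix_flip,
      Matrix.det_one]
  rw [eq_inv_of_mul_eq_one_left h2, abs_inv]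

end GramLinearAlgebra

section ChartFrame

open Module VectorField

variable {E : Type*} [NormedAddCommGroup E] [NormedSpace ℝ E]
  {ι : Type*} [Fintype ι] [DecidableEq ι] [FiniteDimensional ℝ E]
  {H : Type*} [TopologicalSpace H] {I : ModelWithCorners ℝ E H} [I.Boundaryless]
  {M : Type*} [TopologicalSpace M] [ChartedSpace H M] [IsManifold I ∞ M]

theorem isInvertible_mfderiv_extChartAt_symm (x₀ : M) {y : E}
    (hy : y ∈ (extChartAt I x₀).target) :
    (mfderiv 𝓘(ℝ, E) I (extChartAt I x₀).symm y).IsInvertible := by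
  have := isInvertible_mfderivWithin_extChartAt_symm (I := I) hy
  rwa [I.range_eq_univ, mfderivWithin_univ] at this

theorem contMDiffAt_extChartAt_symm (x₀ : M) {y : E} (hy : y ∈ (extChartAt I x₀).target) :
    ContMDiffAt 𝓘(ℝ, E) I ∞ (extChartAt I x₀).symm y :=
  (contMDiffOn_extChartAt_symm x₀).contMDiffAt ((isOpen_extChartAt_target x₀).mem_nhds hy)

/-- A vector field read in the chart around `x₀`. -/
def chartField (x₀ : M) (X : VField I M) (y : E) : E :=
  mpullback 𝓘(ℝ, E) I (extChartAt I x₀).symm X y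

theorem mfderiv_chartField (x₀ : M) (X : VField I M) {y : E}
    (hy : y ∈ (extChartAt I x₀).target) :
    mfderiv 𝓘(ℝ, E) I (extChartAt I x₀).symm y (chartField x₀ X y : E) =
      X ((extChartAt I x₀).symm y) := by
  obtain ⟨D, hD⟩ := isInvertible_mfderiv_extChartAt_symm x₀ hy
  rw [chartField, mpullback_apply, ← hD, ContinuousLinearMap.inverse_equiv]
  exact D.apply_symm_apply _

theorem contDiffOn_chartField (x₀ : M) {X : VField I M} (hX : IsSmoothVField X) :
    ContDiffOn ℝ ∞ (chartField x₀ X) (extChartAt I x₀).target := by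
  intro y hy
  have := ContMDiffAt.mpullback_vectorField_preimage (n := ∞) (m := ∞)
    (hX.contMDiffAt (x := (extChartAt I x₀).symm y)) (contMDiffAt_extChartAt_symm x₀ hy)
    (isInvertible_mfderiv_extChartAt_symm x₀ hy) (by simp)
  exact (contMDiffAt_vectorSpace_iff_contDiffAt.1 this).contDiffWithinAt

theorem lieBracket_chartField (x₀ : M) {X Y : VField I M} (hX : IsSmoothVField X)
    (hY : IsSmoothVField Y) {y : E} (hy : y ∈ (extChartAt I x₀).target) :
    lieBracket ℝ (chartField x₀ X) (chartField x₀ Y) y =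
      chartField x₀ (mlieBracket I X Y) y := by
  have h2 : minSmoothness ℝ 2 = 2 := minSmoothness_of_isRCLikeNormedField
  have h2' : (2 : ℕ∞ω) ≤ ∞ := WithTop.coe_le_coe.2 le_top
  have : IsManifold I (minSmoothness ℝ 2) M := .of_le (n := ∞) (h2.trans_le h2')
  have := mpullback_mlieBracket (n := ∞) (hX.mdifferentiableAt ((extChartAt I x₀).symm y))
    (hY.mdifferentiableAt ((extChartAt I x₀).symm y)) (contMDiffAt_extChartAt_symm x₀ hy)
    (h2.trans_le h2')
  rw [chartField, this, ← mlieBracketWithin_univ, mlieBracketWithin_eq_lieBracketWithin]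
  exact (congrFun lieBracketWithin_univ y).symm

theorem fderiv_chart (x₀ : M) {u : M → ℝ} (X : VField I M) {y : E}
    (hy : y ∈ (extChartAt I x₀).target)
    (hu : MDifferentiableAt I 𝓘(ℝ, ℝ) u ((extChartAt I x₀).symm y)) :
    fderiv ℝ (fun z => u ((extChartAt I x₀).symm z)) y (chartField x₀ X y) =
      mvfderiv I u ((extChartAt I x₀).symm y) (X ((extChartAt I x₀).symm y)) := by
  have h1 := mvfderiv_comp_apply (I' := 𝓘(ℝ, E)) y hu
    ((contMDiffAt_extChartAt_symm x₀ hy).mdifferentiableAt (by simp)) (chartField x₀ X y : E)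
  refine Eq.trans ?_ (h1.trans (congrArg _ (mfderiv_chartField x₀ X hy)))
  rw [mvfderiv, mfderiv_eq_fderiv]
  rfl

theorem contDiffOn_chart (x₀ : M) {u : M → ℝ} (hu : ContMDiff I 𝓘(ℝ, ℝ) ∞ u) :
    ContDiffOn ℝ ∞ (fun z => u ((extChartAt I x₀).symm z)) (extChartAt I x₀).target :=
  contMDiffOn_iff_contDiffOn.1 (hu.comp_contMDiffOn (contMDiffOn_extChartAt_symm x₀))

theorem contMDiff_mvfderiv {u : M → ℝ} (hu : ContMDiff I 𝓘(ℝ, ℝ) ∞ u) {X : VField I M}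
    (hX : IsSmoothVField X) : ContMDiff I 𝓘(ℝ, ℝ) ∞ fun p => mvfderiv I u p (X p) := by
  intro x₀
  have ho := isOpen_extChartAt_target (I := I) x₀
  have h1 : ContDiffOn ℝ ∞ (fun y => fderiv ℝ (fun z => u ((extChartAt I x₀).symm z)) y
      (chartField x₀ X y)) (extChartAt I x₀).target :=
    ((contDiffOn_chart x₀ hu).fderiv_of_isOpen ho (by simp)).clm_apply
      (contDiffOn_chartField x₀ hX)
  have h2 := ((h1.contDiffAt (ho.mem_nhds (mem_extChartAt_target x₀))).contMDiffAt).comp x₀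
    contMDiffAt_extChartAt
  refine h2.congr_of_eventuallyEq ?_
  filter_upwards [extChartAt_source_mem_nhds (I := I) x₀] with p hp
  have := fderiv_chart x₀ X ((extChartAt I x₀).map_source hp) (hu.mdifferentiable (by simp) _)
  rw [Function.comp_apply, this, (extChartAt I x₀).left_inv hp]


namespace IsOrthonormalFrame

variable {g : MetricField I M} {F : ι → VField I M} {c : ι → ι → ι → M → ℝ}

theorem isSmoothVField (h : IsOrthonormalFrame g F c) (i : ι) : IsSmoothVField (F i) :=
  contMDiffOn_univ.1 (h.frame.contMDiffOn i)

theorem contMDiff_coeff (h : IsOrthonormalFrame g F c) {Y : VField I M} (hY : IsSmoothVField Y)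
    (i : ι) : ContMDiff I 𝓘(ℝ, ℝ) ∞ fun p => h.frame.coeff i p (Y p) :=
  fun _ => h.frame.contMDiffAt_coeff hY.contMDiffAt i

theorem contMDiff_koszul (h : IsOrthonormalFrame g F c) (a b d : ι) :
    ContMDiff I 𝓘(ℝ, ℝ) ∞ (koszul c a b d) := by
  have : ContMDiff I 𝓘(ℝ, ℝ) ∞ fun p => (c a b d p - c b d a p + c d a b p) * (1 / 2) :=
    (((h.smooth a b d).sub (h.smooth b d a)).add (h.smooth d a b)).mul contMDiff_const
  convert this using 2 with p
  simp only [koszul]; ring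

/-- The components `⟨∇_{F a} Y, F d⟩` of the covariant derivative. -/
def covDeriv (h : IsOrthonormalFrame g F c) (Y : VField I M) (a d : ι) (p : M) : ℝ :=
  mvfderiv I (fun q => h.frame.coeff d q (Y q)) p (F a p) +
    ∑ b, h.frame.coeff b p (Y p) * koszul c a b d p

theorem contMDiff_covDeriv (h : IsOrthonormalFrame g F c) {Y : VField I M}
    (hY : IsSmoothVField Y) (a d : ι) : ContMDiff I 𝓘(ℝ, ℝ) ∞ (h.covDeriv Y a d) :=
  (contMDiff_mvfderiv (h.contMDiff_coeff hY d) (h.isSmoothVField a)).add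
    (contMDiff_finsetSum fun b _ => (h.contMDiff_coeff hY b).mul (h.contMDiff_koszul a b d))

theorem covDeriv_add_smul (h : IsOrthonormalFrame g F c) {V W : VField I M}
    (hV : IsSmoothVField V) (hW : IsSmoothVField W) (s : ℝ) (a d : ι) (p : M) :
    h.covDeriv (V + s • W) a d p = h.covDeriv V a d p + s * h.covDeriv W a d p := by
  have hv := (h.contMDiff_coeff hV d).mdifferentiable (by simp) p
  have hw := (h.contMDiff_coeff hW d).mdifferentiable (by simp) p
  simp only [covDeriv, Pi.add_apply, Pi.smul_apply, map_add, map_smul, smul_eq_mul]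
  rw [mvfderiv_fun_add (g' := fun q => s * h.frame.coeff d q (W q)) hv
    (mdifferentiableAt_const.mul hw), mvfderiv_fun_mul mdifferentiableAt_const hw, mvfderiv_const]
  simp only [add_apply, smul_apply, smul_eq_mul, smul_zero, add_zero, add_mul,
    Finset.sum_add_distrib, mul_add, Finset.mul_sum, mul_assoc]
  ring

theorem endoNormSq_leviCivita (h : IsOrthonormalFrame g F c)
    {nabla : CovariantDerivative I E (fun p : M => TangentSpace I p)} (hn : IsLeviCivita g nabla)
    {Y : VField I M} (hY : IsSmoothVField Y) (p : M) :
    endoNormSq g p (nabla Y p) = ∑ a, ∑ d, h.covDeriv Y a d p ^ 2 := by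
  let B : Basis ι ℝ (TangentSpace I p) := h.frame.toBasisAt (Set.mem_univ p)
  let b : Basis (Fin (finrank ℝ E)) ℝ (TangentSpace I p) := Module.finBasis ℝ E
  have hB : ∀ u i, h.frame.coeff i p u = B.repr u i := fun u i => by
    rw [IsLocalFrameOn.coeff, dif_pos (Set.mem_univ p)]; rfl
  have hBF : ∀ a, B a = F a p := fun a => h.frame.toBasisAt_coe (Set.mem_univ p) a
  have key := B.sum_gram_inv b (nabla Y p : TangentSpace I p →ₗ[ℝ] TangentSpace I p)
  have e1 : ∀ a d, h.covDeriv Y a d p = B.repr (nabla Y p (B a)) d := fun a d => by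
    rw [← hB, hBF, h.coeff_leviCivita hn (hY.mdifferentiableAt p), h.nablaCoeff_apply_frame]
    rfl
  simp only [e1]
  refine Eq.trans ?_ key
  simp only [endoNormSq, gramMatrix, h.metric_eq, hB]
  rfl

theorem frameDet_eq (h : IsOrthonormalFrame g F c) (x₀ : M) {y : E}
    (hy : y ∈ (extChartAt I x₀).target) (σ : Fin (finrank ℝ E) ≃ ι) :
    ((Module.finBasis ℝ E).reindex σ).det (fun i => chartField x₀ (F i) y) ≠ 0 ∧
    volumeDensity g x₀ y =
      |((Module.finBasis ℝ E).reindex σ).det (fun i => chartField x₀ (F i) y)|⁻¹ := by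
  obtain ⟨D, hD⟩ := isInvertible_mfderiv_extChartAt_symm x₀ hy
  let q := (extChartAt I x₀).symm y
  let D' : E ≃ₗ[ℝ] TangentSpace I q := D.toLinearEquiv
  let B : Basis ι ℝ E := (h.frame.toBasisAt (Set.mem_univ q)).map D'.symm
  have hBF : ∀ a, B a = chartField x₀ (F a) y := fun a => by
    have e : D' (chartField x₀ (F a) y) = F a q := by
      have := mfderiv_chartField x₀ (F a) hy
      rw [← hD] at this
      exact this
    rw [Basis.map_apply, h.frame.toBasisAt_coe (Set.mem_univ q), ← e]
    exact D'.symm_apply_apply _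
  have hBF' : (B : ι → E) = fun a => chartField x₀ (F a) y := funext hBF
  rw [← hBF']
  refine ⟨(Basis.isUnit_det _ B).ne_zero, ?_⟩
  rw [← B.sqrt_det_gram (Module.finBasis ℝ E) σ]
  have hc : ∀ (i : Fin (finrank ℝ E)) (a : ι),
      h.frame.coeff a q (coordVector (I := I) x₀ y i) = B.repr (Module.finBasis ℝ E i) a := by
    intro i a
    rw [IsLocalFrameOn.coeff, dif_pos (Set.mem_univ q), coordVector, ← hD]
    rfl
  rw [volumeDensity, gramMatrix]
  congr 2
  ext i j
  simp only [Matrix.of_apply, h.metric_eq]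
  exact Finset.sum_congr rfl fun a _ => congrArg₂ _ (hc i a) (hc j a)

end IsOrthonormalFrame

end ChartFrame

section Harmonic

open Module VectorField

variable {E : Type*} [NormedAddCommGroup E] [NormedSpace ℝ E] [MeasurableSpace E] [BorelSpace E]
  {ι : Type*} [Fintype ι] [DecidableEq ι] [FiniteDimensional ℝ E]
  {H : Type*} [TopologicalSpace H] {I : ModelWithCorners ℝ E H} [I.Boundaryless]
  {M : Type*} [TopologicalSpace M] [ChartedSpace H M] [IsManifold I ∞ M]

theorem isCompact_chart_image (x₀ : M) {D : Set M} (hD : IsCompact D)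
    (hDs : D ⊆ (chartAt H x₀).source) : IsCompact (extChartAt I x₀ '' D) := by
  rw [← extChartAt_source I x₀] at hDs
  exact hD.image_of_continuousOn ((continuousOn_extChartAt x₀).mono hDs)

theorem chart_image_subset_target (x₀ : M) {D : Set M}
    (hDs : D ⊆ (chartAt H x₀).source) : extChartAt I x₀ '' D ⊆ (extChartAt I x₀).target := by
  rw [← extChartAt_source I x₀] at hDs
  rintro _ ⟨p, hp, rfl⟩
  exact (extChartAt I x₀).map_source (hDs hp)

namespace IsOrthonormalFrame

variable {g : MetricField I M} {F : ι → VField I M} {c : ι → ι → ι → M → ℝ}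

theorem exists_indexEquiv (h : IsOrthonormalFrame g F c) (p : M) :
    Nonempty (Fin (finrank ℝ E) ≃ ι) := by
  obtain ⟨b⟩ := h.frame.exists_modelBasis p
  exact ⟨(Module.finBasis ℝ E).indexEquiv b⟩

theorem continuousOn_volumeDensity (h : IsOrthonormalFrame g F c) (x₀ : M) :
    ContinuousOn (volumeDensity g x₀) (extChartAt I x₀).target := by
  obtain ⟨σ⟩ := h.exists_indexEquiv x₀
  have h1 : ContinuousOn (fun y => |((Module.finBasis ℝ E).reindex σ).det
      (fun i => chartField x₀ (F i) y)|⁻¹) (extChartAt I x₀).target := by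
    refine ContinuousOn.inv₀ (ContinuousOn.abs ?_) fun y hy =>
      abs_ne_zero.2 (h.frameDet_eq x₀ hy σ).1
    exact (Basis.contDiff_det _).continuous.comp_continuousOn
      (continuousOn_pi.2 fun i => (contDiffOn_chartField x₀ (h.isSmoothVField i)).continuousOn)
  exact h1.congr fun y hy => (h.frameDet_eq x₀ hy σ).2

theorem volumeDensity_pos (h : IsOrthonormalFrame g F c) (x₀ : M) {y : E}
    (hy : y ∈ (extChartAt I x₀).target) : 0 < volumeDensity g x₀ y := by
  obtain ⟨σ⟩ := h.exists_indexEquiv x₀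
  obtain ⟨h1, h2⟩ := h.frameDet_eq x₀ hy σ
  rw [h2]
  positivity

theorem integrableOn_chart (h : IsOrthonormalFrame g F c) (x₀ : M) {D : Set M}
    (hD : IsCompact D) (hDs : D ⊆ (chartAt H x₀).source) {u : M → ℝ}
    (hu : ContMDiff I 𝓘(ℝ, ℝ) ∞ u) :
    IntegrableOn (fun y => u ((extChartAt I x₀).symm y) * volumeDensity g x₀ y)
      (extChartAt I x₀ '' D) (Module.finBasis ℝ E).addHaar := by
  have hs := chart_image_subset_target (I := I) x₀ hDs
  exact (((contDiffOn_chart x₀ hu).continuousOn.mono hs).mul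
    ((h.continuousOn_volumeDensity x₀).mono hs)).integrableOn_compact
      (isCompact_chart_image x₀ hD hDs)

/-- The pointwise inner product `⟨∇V, ∇W⟩`. -/
def innerCovDeriv (h : IsOrthonormalFrame g F c) (V W : VField I M) (p : M) : ℝ :=
  ∑ a, ∑ d, h.covDeriv V a d p * h.covDeriv W a d p

theorem contMDiff_innerCovDeriv (h : IsOrthonormalFrame g F c) {V W : VField I M}
    (hV : IsSmoothVField V) (hW : IsSmoothVField W) :
    ContMDiff I 𝓘(ℝ, ℝ) ∞ (h.innerCovDeriv V W) :=
  contMDiff_finsetSum fun a _ => contMDiff_finsetSum fun d _ =>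
    (h.contMDiff_covDeriv hV a d).mul (h.contMDiff_covDeriv hW a d)

theorem smooth_add_smul {V W : VField I M} (hV : IsSmoothVField V)
    (hW : IsSmoothVField W) (s : ℝ) : IsSmoothVField (V + s • W) :=
  ContMDiff.add_section hV (ContMDiff.const_smul_section hW)

theorem hasDerivAt_verticalEnergy (h : IsOrthonormalFrame g F c)
    {nabla : CovariantDerivative I E (fun p : M => TangentSpace I p)} (hn : IsLeviCivita g nabla)
    (x₀ : M) {D : Set M} (hD : IsCompact D) (hDs : D ⊆ (chartAt H x₀).source) {V W : VField I M}
    (hV : IsSmoothVField V) (hW : IsSmoothVField W) :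
    HasDerivAt (fun s : ℝ => verticalEnergy g nabla x₀ D (V + s • W))
      (∫ y in extChartAt I x₀ '' D, h.innerCovDeriv V W ((extChartAt I x₀).symm y) *
        volumeDensity g x₀ y ∂(Module.finBasis ℝ E).addHaar) 0 := by
  set μ := (Module.finBasis ℝ E).addHaar
  set K := extChartAt I x₀ '' D
  let T : VField I M → VField I M → ℝ := fun X Y =>
    ∫ y in K, h.innerCovDeriv X Y ((extChartAt I x₀).symm y) * volumeDensity g x₀ y ∂μ
  have hint : ∀ {X Y : VField I M}, IsSmoothVField X → IsSmoothVField Y → IntegrableOn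
      (fun y => h.innerCovDeriv X Y ((extChartAt I x₀).symm y) * volumeDensity g x₀ y) K μ :=
    fun hX hY => h.integrableOn_chart x₀ hD hDs (h.contMDiff_innerCovDeriv hX hY)
  have e : ∀ s : ℝ, verticalEnergy g nabla x₀ D (V + s • W) =
      (1 / 2) * (T V V + s * (2 * T V W) + s ^ 2 * T W W) := by
    intro s
    have e1 : ∀ y, endoNormSq g ((extChartAt I x₀).symm y)
        (nabla (V + s • W) ((extChartAt I x₀).symm y)) * volumeDensity g x₀ y =
        (h.innerCovDeriv V V ((extChartAt I x₀).symm y) * volumeDensity g x₀ y +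
        s * (2 * (h.innerCovDeriv V W ((extChartAt I x₀).symm y) * volumeDensity g x₀ y))) +
        s ^ 2 * (h.innerCovDeriv W W ((extChartAt I x₀).symm y) * volumeDensity g x₀ y) := by
      intro y
      rw [h.endoNormSq_leviCivita hn (smooth_add_smul hV hW s)]
      have : ∑ a, ∑ d, h.covDeriv (V + s • W) a d ((extChartAt I x₀).symm y) ^ 2 =
          h.innerCovDeriv V V ((extChartAt I x₀).symm y) +
          s * (2 * h.innerCovDeriv V W ((extChartAt I x₀).symm y)) +
          s ^ 2 * h.innerCovDeriv W W ((extChartAt I x₀).symm y) := by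
        simp only [innerCovDeriv, Finset.mul_sum, ← Finset.sum_add_distrib,
          h.covDeriv_add_smul hV hW]
        exact Finset.sum_congr rfl fun a _ => Finset.sum_congr rfl fun d _ => by ring
      rw [this]; ring
    rw [verticalEnergy]
    simp only [e1]
    congr 1
    refine (integral_add (f := fun y => h.innerCovDeriv V V ((extChartAt I x₀).symm y) *
      volumeDensity g x₀ y + s * (2 * (h.innerCovDeriv V W ((extChartAt I x₀).symm y) *
        volumeDensity g x₀ y))) ((hint hV hV).add (((hint hV hW).const_mul 2).const_mul s))
      ((hint hW hW).const_mul (s ^ 2))).trans ?_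
    rw [integral_add (hint hV hV) (((hint hV hW).const_mul 2).const_mul s), integral_const_mul,
      integral_const_mul, integral_const_mul]
  simp only [e]
  have : HasDerivAt (fun s : ℝ => (1 / 2) * (T V V + s * (2 * T V W) + s ^ 2 * T W W))
      ((1 / 2) * (0 + 1 * (2 * T V W) + (2 * (0 : ℝ) ^ (2 - 1) * 1) * T W W)) 0 :=
    ((((hasDerivAt_const _ _).add ((hasDerivAt_id _).mul_const _))).add
      (((hasDerivAt_id _).pow 2).mul_const _)).const_mul _
  convert this using 1
  simp
  rfl

/-- The components of the rough Laplacian `∑ ∇²_{F a, F a} V` of `V` in the frame. -/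
def roughLaplacian (h : IsOrthonormalFrame g F c) (V : VField I M) (d : ι) (p : M) : ℝ :=
  ∑ a, (mvfderiv I (h.covDeriv V a d) p (F a p) - h.covDeriv V a d p * ∑ b, c a b b p +
    ∑ b, h.covDeriv V a b p * koszul c a b d p)

theorem contMDiff_roughLaplacian (h : IsOrthonormalFrame g F c) {V : VField I M}
    (hV : IsSmoothVField V) (d : ι) : ContMDiff I 𝓘(ℝ, ℝ) ∞ (h.roughLaplacian V d) :=
  contMDiff_finsetSum fun a _ =>
    ((contMDiff_mvfderiv (h.contMDiff_covDeriv hV a d) (h.isSmoothVField a)).sub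
      ((h.contMDiff_covDeriv hV a d).mul (contMDiff_finsetSum fun b _ => h.smooth a b b))).add
    (contMDiff_finsetSum fun b _ => (h.contMDiff_covDeriv hV a b).mul (h.contMDiff_koszul a b d))

theorem innerCovDeriv_add (h : IsOrthonormalFrame g F c) {V W : VField I M}
    (hV : IsSmoothVField V) (hW : IsSmoothVField W) (p : M) :
    h.innerCovDeriv V W p + ∑ d, h.frame.coeff d p (W p) * h.roughLaplacian V d p =
      ∑ a, ∑ d, (mvfderiv I (fun q => h.covDeriv V a d q * h.frame.coeff d q (W q)) p (F a p) -
        h.covDeriv V a d p * h.frame.coeff d p (W p) * ∑ b, c a b b p) := by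
  have h1 : ∀ a d, mvfderiv I (fun q => h.covDeriv V a d q * h.frame.coeff d q (W q)) p (F a p) =
      h.covDeriv V a d p * mvfderiv I (fun q => h.frame.coeff d q (W q)) p (F a p) +
      h.frame.coeff d p (W p) * mvfderiv I (h.covDeriv V a d) p (F a p) := by
    intro a d
    rw [mvfderiv_fun_mul ((h.contMDiff_covDeriv hV a d).mdifferentiable (by simp) p)
      ((h.contMDiff_coeff hW d).mdifferentiable (by simp) p)]
    rfl
  have h2 : ∀ a, ∑ d, h.covDeriv V a d p * (∑ b, h.frame.coeff b p (W p) * koszul c a b d p) +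
      ∑ d, h.frame.coeff d p (W p) * (∑ b, h.covDeriv V a b p * koszul c a b d p) = 0 := by
    intro a
    simp only [Finset.mul_sum]
    conv_lhs => arg 2; rw [Finset.sum_comm]
    rw [← Finset.sum_add_distrib]
    refine Finset.sum_eq_zero fun d _ => ?_
    rw [← Finset.sum_add_distrib]
    refine Finset.sum_eq_zero fun b _ => ?_
    rw [h.koszul_antisymm a b d p]
    ring
  have h3 : ∑ d, h.frame.coeff d p (W p) * h.roughLaplacian V d p =
      ∑ a, ∑ d, h.frame.coeff d p (W p) * (mvfderiv I (h.covDeriv V a d) p (F a p) -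
        h.covDeriv V a d p * ∑ b, c a b b p + ∑ b, h.covDeriv V a b p * koszul c a b d p) := by
    simp only [roughLaplacian, Finset.mul_sum (s := (Finset.univ : Finset ι))
      (f := fun a => mvfderiv I _ p (F a p) - _ + _)]
    rw [Finset.sum_comm]
  rw [h3, innerCovDeriv, ← Finset.sum_add_distrib]
  refine Finset.sum_congr rfl fun a _ => ?_
  simp only [h1]
  have := h2 a
  conv_lhs => arg 1; simp only [covDeriv.eq_1 (Y := W), mul_add]
  simp only [mul_add, mul_sub, Finset.sum_add_distrib, Finset.sum_sub_distrib] at this ⊢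
  have e : ∀ d, h.frame.coeff d p (W p) * (h.covDeriv V a d p * ∑ b, c a b b p) =
      h.covDeriv V a d p * h.frame.coeff d p (W p) * ∑ b, c a b b p := fun d => by ring
  simp only [e]
  linarith

theorem integral_innerCovDeriv (h : IsOrthonormalFrame g F c)
    (x₀ : M) {D : Set M} (hD : IsCompact D) (hDs : D ⊆ (chartAt H x₀).source) {V W : VField I M}
    (hV : IsSmoothVField V) (hW : IsSmoothVField W) (hWD : ∀ p, p ∉ D → W p = 0) :
    ∫ y in extChartAt I x₀ '' D, h.innerCovDeriv V W ((extChartAt I x₀).symm y) *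
        volumeDensity g x₀ y ∂(Module.finBasis ℝ E).addHaar =
    - ∫ y in extChartAt I x₀ '' D, (∑ d, h.frame.coeff d ((extChartAt I x₀).symm y)
        (W ((extChartAt I x₀).symm y)) * h.roughLaplacian V d ((extChartAt I x₀).symm y)) *
        volumeDensity g x₀ y ∂(Module.finBasis ℝ E).addHaar := by
  set μ := (Module.finBasis ℝ E).addHaar
  set K := extChartAt I x₀ '' D with hKdef
  have hK : IsCompact K := isCompact_chart_image x₀ hD hDs
  have hKs : K ⊆ (extChartAt I x₀).target := chart_image_subset_target (I := I) x₀ hDs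
  obtain ⟨σ⟩ := h.exists_indexEquiv x₀
  have hu : ∀ a d, ContMDiff I 𝓘(ℝ, ℝ) ∞
      (fun q => h.covDeriv V a d q * h.frame.coeff d q (W q)) := fun a d =>
    (h.contMDiff_covDeriv hV a d).mul (h.contMDiff_coeff hW d)
  have hdiv : ∀ a d, ContMDiff I 𝓘(ℝ, ℝ) ∞ (fun p =>
      mvfderiv I (fun q => h.covDeriv V a d q * h.frame.coeff d q (W q)) p (F a p) -
        h.covDeriv V a d p * h.frame.coeff d p (W p) * ∑ b, c a b b p) := fun a d =>
    (contMDiff_mvfderiv (hu a d) (h.isSmoothVField a)).sub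
      ((hu a d).mul (contMDiff_finsetSum fun b _ => h.smooth a b b))
  have hI1 := h.integrableOn_chart x₀ hD hDs (h.contMDiff_innerCovDeriv hV hW)
  have hI2 := h.integrableOn_chart x₀ hD hDs (u := fun p => ∑ d, h.frame.coeff d p (W p) *
    h.roughLaplacian V d p) (contMDiff_finsetSum fun d _ =>
      (h.contMDiff_coeff hW d).mul (h.contMDiff_roughLaplacian hV d))
  have hI3 := fun a d => h.integrableOn_chart x₀ hD hDs (hdiv a d)
  rw [eq_neg_iff_add_eq_zero, ← integral_add hI1 hI2]
  have e : ∀ p, ∀ r : ℝ, h.innerCovDeriv V W p * r +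
      (∑ d, h.frame.coeff d p (W p) * h.roughLaplacian V d p) * r =
      ∑ a, ∑ d, (mvfderiv I (fun q => h.covDeriv V a d q * h.frame.coeff d q (W q)) p (F a p) -
        h.covDeriv V a d p * h.frame.coeff d p (W p) * ∑ b, c a b b p) * r := fun p r => by
    rw [← add_mul, h.innerCovDeriv_add hV hW]
    simp only [Finset.sum_mul]
  simp only [e]
  rw [integral_finsetSum _ fun a _ => integrable_finsetSum _ fun d _ => hI3 a d]
  refine Finset.sum_eq_zero fun a _ => ?_
  rw [integral_finsetSum _ fun d _ => hI3 a d]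
  refine Finset.sum_eq_zero fun d _ => ?_
  have key := integral_frame_divergence μ ((Module.finBasis ℝ E).reindex σ)
    (isOpen_extChartAt_target (I := I) x₀) hK hKs (X := fun i => chartField x₀ (F i))
    (fun i => (contDiffOn_chartField x₀ (h.isSmoothVField i)).of_le (by simp))
    (c := fun y i j k => c i j k ((extChartAt I x₀).symm y)) (fun y hy i j => by
      rw [lieBracket_chartField x₀ (h.isSmoothVField i) (h.isSmoothVField j) hy]
      simp only [chartField, mpullback_apply, h.bracket, map_sum, map_smul]
      rfl)
    (fun y hy => (h.frameDet_eq x₀ hy σ).1) ((contDiffOn_chart x₀ (hu a d)).of_le (by simp))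
    (fun y hy => by
      have : (extChartAt I x₀).symm y ∉ D := fun hyD =>
        hy.2 ⟨_, hyD, (extChartAt I x₀).right_inv hy.1⟩
      simp only [hWD _ this, map_zero, mul_zero]) a
  rw [← key]
  refine setIntegral_congr_fun hK.measurableSet fun y hy => ?_
  simp only [fderiv_chart x₀ (F a) (hKs hy) ((hu a d).mdifferentiable (by simp) _),
    (h.frameDet_eq x₀ (hKs hy) σ).2]

/-- Harmonic vector fields are the smooth fields with vanishing rough Laplacian. -/
theorem isHarmonicVectorField_iff [T2Space M] (h : IsOrthonormalFrame g F c) (V : VField I M) :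
    IsHarmonicVectorField g V ↔ IsSmoothVField V ∧ ∀ d p, h.roughLaplacian V d p = 0 := by
  constructor
  · rintro ⟨hV, nabla, hn, hcrit⟩
    refine ⟨hV, fun d p₀ => ?_⟩
    by_contra hne
    obtain ⟨ψ⟩ : Nonempty (SmoothBumpFunction I p₀) := inferInstance
    have hψ : ContMDiff I 𝓘(ℝ, ℝ) ∞ ψ := ψ.contMDiff
    let w : M → ℝ := fun p => ψ p * h.roughLaplacian V d p
    have hw : ContMDiff I 𝓘(ℝ, ℝ) ∞ w := hψ.mul (h.contMDiff_roughLaplacian hV d)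
    let W : VField I M := w • F d
    have hW : IsSmoothVField W := ContMDiff.smul_section hw (h.isSmoothVField d)
    have hDs := ψ.tsupport_subset_chartAt_source
    have hD : IsCompact (tsupport ψ) := ψ.hasCompactSupport
    have hW0 : ∀ p, p ∉ tsupport ψ → W p = 0 := fun p hp => by
      simp [W, w, image_eq_zero_of_notMem_tsupport hp]
    have h0 := (hcrit p₀ _ hD hDs W hW hW0).unique
      (h.hasDerivAt_verticalEnergy hn p₀ hD hDs hV hW)
    rw [h.integral_innerCovDeriv p₀ hD hDs hV hW hW0, eq_comm, neg_eq_zero] at h0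
    have hcW : ∀ i p, h.frame.coeff i p (W p) = if i = d then w p else 0 := fun i p => by
      simp [W, h.frame.coeff_frame]
    simp only [hcW, ite_mul, zero_mul, Finset.sum_ite_eq', Finset.mem_univ, if_true] at h0
    have hKs := chart_image_subset_target (I := I) p₀ hDs
    have hint := h.integrableOn_chart p₀ hD hDs (hw.mul (h.contMDiff_roughLaplacian hV d))
    have hnn : ∀ p, 0 ≤ w p * h.roughLaplacian V d p := fun p => by
      simp only [w, mul_assoc]
      exact mul_nonneg ψ.nonneg (mul_self_nonneg _)
    refine absurd h0 (ne_of_gt ((setIntegral_pos_iff_support_of_nonneg_ae ?_ hint).2 ?_))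
    swap
    · set O : Set E := (extChartAt I p₀).target ∩ (extChartAt I p₀).symm ⁻¹'
        {p | ψ p * h.roughLaplacian V d p ≠ 0} with hO
      have hOo : IsOpen O := (continuousOn_extChartAt_symm p₀).isOpen_inter_preimage
        (isOpen_extChartAt_target p₀) (isOpen_ne_fun hw.continuous continuous_const)
      have hOn : O.Nonempty := ⟨extChartAt I p₀ p₀, mem_extChartAt_target p₀, by
        simp [hne]⟩
      refine (hOo.measure_pos _ hOn).trans_le (measure_mono fun y hy => ?_)
      have h1 : ψ ((extChartAt I p₀).symm y) ≠ 0 := left_ne_zero_of_mul hy.2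
      have h2 : h.roughLaplacian V d ((extChartAt I p₀).symm y) ≠ 0 := right_ne_zero_of_mul hy.2
      refine ⟨mul_ne_zero (mul_ne_zero hy.2 h2) (h.volumeDensity_pos p₀ hy.1).ne',
        _, subset_tsupport _ h1, (extChartAt I p₀).right_inv hy.1⟩
    · exact ae_restrict_of_forall_mem (isCompact_chart_image p₀ hD hDs).measurableSet fun y hy =>
        mul_nonneg (hnn _) (h.volumeDensity_pos p₀ (hKs hy)).le
  · rintro ⟨hV, h0⟩
    refine ⟨hV, h.connection, h.isLeviCivita_connection, fun x₀ D hD hDs W hW hWD => ?_⟩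
    have := h.hasDerivAt_verticalEnergy h.isLeviCivita_connection x₀ hD hDs hV hW
    rw [h.integral_innerCovDeriv x₀ hD hDs hV hW hWD] at this
    simpa [h0] using this

end IsOrthonormalFrame

end Harmonic

section ProductFields

open Module VectorField

variable {E₁ : Type*} [NormedAddCommGroup E₁] [NormedSpace ℝ E₁] [FiniteDimensional ℝ E₁]
  {H₁ : Type*} [TopologicalSpace H₁] {I₁ : ModelWithCorners ℝ E₁ H₁} [I₁.Boundaryless]
  {M₁ : Type*} [TopologicalSpace M₁] [ChartedSpace H₁ M₁] [IsManifold I₁ ∞ M₁]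
  {E₂ : Type*} [NormedAddCommGroup E₂] [NormedSpace ℝ E₂] [FiniteDimensional ℝ E₂]
  {H₂ : Type*} [TopologicalSpace H₂] {I₂ : ModelWithCorners ℝ E₂ H₂} [I₂.Boundaryless]
  {M₂ : Type*} [TopologicalSpace M₂] [ChartedSpace H₂ M₂] [IsManifold I₂ ∞ M₂]

/-- The field `(A, B)` on a product manifold. -/
def prodField (A : VField I₁ M₁) (B : VField I₂ M₂) : VField (I₁.prod I₂) (M₁ × M₂) :=
  fun p => ((A p.1, B p.2) : E₁ × E₂)

theorem isSmoothVField_prodField {A : VField I₁ M₁} {B : VField I₂ M₂} (hA : IsSmoothVField A)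
    (hB : IsSmoothVField B) : IsSmoothVField (prodField A B) := by
  have h1 : ContMDiff (I₁.prod I₂) (I₁.tangent.prod I₂.tangent) ∞ fun p : M₁ × M₂ =>
      ((⟨p.1, A p.1⟩ : TangentBundle I₁ M₁), (⟨p.2, B p.2⟩ : TangentBundle I₂ M₂)) :=
    (hA.comp contMDiff_fst).prodMk (hB.comp contMDiff_snd)
  exact (contMDiff_equivTangentBundleProd_symm (I := I₁) (M := M₁) (I' := I₂) (M' := M₂)
    (n := ∞)).comp h1

theorem chartField_prodField {A : VField I₁ M₁} {B : VField I₂ M₂} (p : M₁ × M₂) {y : E₁ × E₂}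
    (hy : y ∈ (extChartAt (I₁.prod I₂) p).target) :
    chartField p (prodField A B) y = (chartField p.1 A y.1, chartField p.2 B y.2) := by
  have hy' := hy
  rw [extChartAt_prod] at hy'
  obtain ⟨hy1, hy2⟩ : y.1 ∈ (extChartAt I₁ p.1).target ∧ y.2 ∈ (extChartAt I₂ p.2).target := hy'
  have hD := (contMDiffAt_extChartAt_symm (I := I₁.prod I₂) p hy).mdifferentiableAt (by simp)
  have hD1 := (contMDiffAt_extChartAt_symm (I := I₁) p.1 hy1).mdifferentiableAt (by simp)
  have hD2 := (contMDiffAt_extChartAt_symm (I := I₂) p.2 hy2).mdifferentiableAt (by simp)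
  have hq := mfderiv_chartField p (prodField A B) hy
  have e1 : (Prod.fst : M₁ × M₂ → M₁) ∘ (extChartAt (I₁.prod I₂) p).symm =
      (extChartAt I₁ p.1).symm ∘ (Prod.fst : E₁ × E₂ → E₁) := by
    rw [extChartAt_prod]; rfl
  have e2 : (Prod.snd : M₁ × M₂ → M₂) ∘ (extChartAt (I₁.prod I₂) p).symm =
      (extChartAt I₂ p.2).symm ∘ (Prod.snd : E₁ × E₂ → E₂) := by
    rw [extChartAt_prod]; rfl
  set D := mfderiv 𝓘(ℝ, E₁ × E₂) (I₁.prod I₂) (extChartAt (I₁.prod I₂) p).symm y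
  have a1 := (hasMFDerivAt_fst (I := I₁) (I' := I₂)
    ((extChartAt (I₁.prod I₂) p).symm y)).comp y hD.hasMFDerivAt
  have a2 := (hasMFDerivAt_snd (I := I₁) (I' := I₂)
    ((extChartAt (I₁.prod I₂) p).symm y)).comp y hD.hasMFDerivAt
  have b1 := HasMFDerivAt.comp (I := 𝓘(ℝ, E₁ × E₂)) y hD1.hasMFDerivAt
    (hasFDerivAt_fst (𝕜 := ℝ) (p := y)).hasMFDerivAt
  have b2 := HasMFDerivAt.comp (I := 𝓘(ℝ, E₁ × E₂)) y hD2.hasMFDerivAt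
    (hasFDerivAt_snd (𝕜 := ℝ) (p := y)).hasMFDerivAt
  rw [e1] at a1
  rw [e2] at a2
  have c1 := congrArg (fun L : E₁ × E₂ →L[ℝ] E₁ => L (chartField p (prodField A B) y))
    (hasMFDerivAt_unique a1 b1)
  have c2 := congrArg (fun L : E₁ × E₂ →L[ℝ] E₂ => L (chartField p (prodField A B) y))
    (hasMFDerivAt_unique a2 b2)
  have q1 := mfderiv_chartField p.1 A hy1
  have q2 := mfderiv_chartField p.2 B hy2
  have f1 : (extChartAt (I₁.prod I₂) p).symm y =
      ((extChartAt I₁ p.1).symm y.1, (extChartAt I₂ p.2).symm y.2) := by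
    rw [extChartAt_prod]; rfl
  have d1 : (mfderiv 𝓘(ℝ, E₁) I₁ (extChartAt I₁ p.1).symm y.1 : E₁ →L[ℝ] E₁)
      (chartField p (prodField A B) y).1 = (prodField A B ((extChartAt (I₁.prod I₂) p).symm y)).1 :=
    c1.symm.trans (congrArg Prod.fst hq)
  have d2 : (mfderiv 𝓘(ℝ, E₂) I₂ (extChartAt I₂ p.2).symm y.2 : E₂ →L[ℝ] E₂)
      (chartField p (prodField A B) y).2 = (prodField A B ((extChartAt (I₁.prod I₂) p).symm y)).2 :=
    c2.symm.trans (congrArg Prod.snd hq)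
  rw [f1] at d1 d2
  have j1 := (isInvertible_mfderiv_extChartAt_symm (I := I₁) p.1 hy1).injective
  have j2 := (isInvertible_mfderiv_extChartAt_symm (I := I₂) p.2 hy2).injective
  exact Prod.ext (j1 (d1.trans q1.symm)) (j2 (d2.trans q2.symm))

theorem mlieBracket_prodField {A A' : VField I₁ M₁} {B B' : VField I₂ M₂}
    (hA : IsSmoothVField A) (hB : IsSmoothVField B) (hA' : IsSmoothVField A')
    (hB' : IsSmoothVField B') (p : M₁ × M₂) :
    mlieBracket (I₁.prod I₂) (prodField A B) (prodField A' B') p =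
      prodField (mlieBracket I₁ A A') (mlieBracket I₂ B B') p := by
  set φ := extChartAt (I₁.prod I₂) p
  have hy : φ p ∈ φ.target := mem_extChartAt_target p
  have hy' := hy
  simp only [φ] at hy'
  rw [extChartAt_prod] at hy'
  obtain ⟨hy1, hy2⟩ : (φ p).1 ∈ (extChartAt I₁ p.1).target ∧
    (φ p).2 ∈ (extChartAt I₂ p.2).target := hy'
  have hev : ∀ (A : VField I₁ M₁) (B : VField I₂ M₂), chartField p (prodField A B)
      =ᶠ[nhds (φ p)] fun y => (chartField p.1 A y.1, chartField p.2 B y.2) := fun A B => by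
    filter_upwards [(isOpen_extChartAt_target p).mem_nhds hy] with y hy
    exact chartField_prodField p hy
  have hfd : ∀ {A : VField I₁ M₁} {B : VField I₂ M₂}, IsSmoothVField A → IsSmoothVField B → ∀ w,
      fderiv ℝ (chartField p (prodField A B)) (φ p) w =
      (fderiv ℝ (chartField p.1 A) (φ p).1 w.1, fderiv ℝ (chartField p.2 B) (φ p).2 w.2) := by
    intro A B hA hB w
    have d1 := ((contDiffOn_chartField p.1 hA).contDiffAt
      ((isOpen_extChartAt_target p.1).mem_nhds hy1)).differentiableAt (by simp)
    have d2 := ((contDiffOn_chartField p.2 hB).contDiffAt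
      ((isOpen_extChartAt_target p.2).mem_nhds hy2)).differentiableAt (by simp)
    rw [(hev A B).fderiv_eq]
    have := (d1.hasFDerivAt.comp (φ p) hasFDerivAt_fst).prodMk
      (d2.hasFDerivAt.comp (φ p) hasFDerivAt_snd)
    exact congrArg (fun L : E₁ × E₂ →L[ℝ] E₁ × E₂ => L w) this.fderiv
  have key : chartField p (mlieBracket (I₁.prod I₂) (prodField A B) (prodField A' B')) (φ p) =
      chartField p (prodField (mlieBracket I₁ A A') (mlieBracket I₂ B B')) (φ p) := by
    rw [← lieBracket_chartField p (isSmoothVField_prodField hA hB)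
      (isSmoothVField_prodField hA' hB') hy, chartField_prodField p hy,
      ← lieBracket_chartField p.1 hA hA' hy1, ← lieBracket_chartField p.2 hB hB' hy2]
    simp only [lieBracket, hfd hA hB, hfd hA' hB', chartField_prodField p hy, Prod.mk_sub_mk]
  have h1 := mfderiv_chartField p (mlieBracket (I₁.prod I₂) (prodField A B) (prodField A' B')) hy
  have h2 := mfderiv_chartField p (prodField (mlieBracket I₁ A A') (mlieBracket I₂ B B')) hy
  rw [key, h2] at h1
  rw [show φ.symm (φ p) = p from extChartAt_to_inv p] at h1
  exact h1.symm

end ProductFields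

section Interval

variable (J : TopologicalSpace.Opens ℝ)

theorem mfderiv_opens_val (t : J) :
    mfderiv 𝓘(ℝ, ℝ) 𝓘(ℝ, ℝ) (Subtype.val : J → ℝ) t = ContinuousLinearMap.id ℝ ℝ := by
  have hd : MDifferentiableAt 𝓘(ℝ, ℝ) 𝓘(ℝ, ℝ) (Subtype.val : J → ℝ) t :=
    (contMDiff_subtype_val (n := ∞)).mdifferentiable (by simp) t
  rw [hd.mfderiv]
  have hw : writtenInExtChartAt 𝓘(ℝ, ℝ) 𝓘(ℝ, ℝ) t (Subtype.val : J → ℝ)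
      =ᶠ[nhds (t : ℝ)] id := by
    have := TopologicalSpace.Opens.chartAt_subtype_val_symm_eventuallyEq (H := ℝ) J (x := t)
    filter_upwards [this] with s hs
    exact hs.symm
  have := hw.fderiv_eq (𝕜 := ℝ)
  rw [fderiv_id] at this
  rw [modelWithCornersSelf_coe, Set.range_id, fderivWithin_univ]
  exact this

/-- The unit vector field on an open subset of the line. -/
def unitField : VField 𝓘(ℝ, ℝ) J := fun _ => (1 : ℝ)

theorem isSmoothVField_unitField : IsSmoothVField (unitField J) := by
  have hc : ContMDiff 𝓘(ℝ, ℝ) 𝓘(ℝ, ℝ).tangent ∞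
      (fun s : ℝ => (⟨s, (1 : ℝ)⟩ : TangentBundle 𝓘(ℝ, ℝ) ℝ)) := by
    exact contMDiff_vectorSpace_iff_contDiff.2 contDiff_const
  have hinv : ∀ t : J, (mfderiv 𝓘(ℝ, ℝ) 𝓘(ℝ, ℝ) (Subtype.val : J → ℝ) t).IsInvertible := by
    intro t
    rw [mfderiv_opens_val]
    exact ContinuousLinearMap.isInvertible_equiv (f := ContinuousLinearEquiv.refl ℝ ℝ)
  have := ContMDiff.mpullback_vectorField (n := ∞) (m := ∞) (f := (Subtype.val : J → ℝ))
    (V := fun _ => (1 : ℝ)) hc (contMDiff_subtype_val) hinv (by simp)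
  have he : VectorField.mpullback 𝓘(ℝ, ℝ) 𝓘(ℝ, ℝ) (Subtype.val : J → ℝ) (fun _ => (1 : ℝ)) =
      unitField J := by
    funext t
    change (mfderiv 𝓘(ℝ, ℝ) 𝓘(ℝ, ℝ) (Subtype.val : J → ℝ) t).inverse (1 : ℝ) = (1 : ℝ)
    rw [mfderiv_opens_val]
    exact congrArg (fun L : ℝ →L[ℝ] ℝ => L 1)
      (ContinuousLinearMap.inverse_id (R := ℝ) (M := ℝ))
  rw [he] at this
  exact this

theorem contMDiff_comp_val {u : ℝ → ℝ} (hu : ContDiffOn ℝ ∞ u J) :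
    ContMDiff 𝓘(ℝ, ℝ) 𝓘(ℝ, ℝ) ∞ (fun t : J => u t) := fun t =>
  (hu.contDiffAt (J.isOpen.mem_nhds t.2)).contMDiffAt.comp t (contMDiff_subtype_val t)

end Interval

section InvariantFields

open VectorField

variable {E : Type*} [NormedAddCommGroup E] [NormedSpace ℝ E]
  {H : Type*} [TopologicalSpace H] {I : ModelWithCorners ℝ E H}
  {G : Type*} [TopologicalSpace G] [ChartedSpace H G] [Group G] [LieGroup I ∞ G]

theorem mulInvariantVectorField_smooth (v : GroupLieAlgebra I G) :
    ContMDiff I I.tangent ∞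
      (fun g : G => (⟨g, mulInvariantVectorField v g⟩ : TangentBundle I G)) := by
  let F₁ : G → (TangentBundle I G × TangentBundle I G) := fun g =>
    (TotalSpace.mk' E g (0 : TangentSpace I g), TotalSpace.mk' E 1 v)
  have S₁ : ContMDiff I (I.tangent.prod I.tangent) ∞ F₁ :=
    (contMDiff_zeroSection ℝ (fun g : G => TangentSpace I g)).prodMk contMDiff_const
  have S₂ : ContMDiff (I.tangent.prod I.tangent) (I.prod I).tangent ∞
      (equivTangentBundleProd I G I G).symm := contMDiff_equivTangentBundleProd_symm
  have S₃ : ContMDiff (I.prod I).tangent I.tangent ∞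
      (tangentMap (I.prod I) I (fun p : G × G => p.1 * p.2)) :=
    ContMDiff.contMDiff_tangentMap (n := ∞) (contMDiff_mul I ∞) (by simp)
  have S := (S₃.comp S₂).comp S₁
  have he : (fun g : G => (⟨g, mulInvariantVectorField v g⟩ : TangentBundle I G)) =
      (tangentMap (I.prod I) I (fun p : G × G => p.1 * p.2) ∘
        (equivTangentBundleProd I G I G).symm) ∘ F₁ := by
    funext g
    have hm : MDifferentiableAt (I.prod I) I (fun p : G × G => p.1 * p.2) (g, 1) :=
      (contMDiff_mul I ∞).mdifferentiableAt (by simp)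
    have h0 : mfderiv (I.prod I) I (fun p : G × G => p.1 * p.2) (g, 1) ((0, v) : E × E) =
        mfderiv I I (fun z : G => g * z) 1 v := by
      refine (mfderiv_prod_eq_add_apply hm).trans ?_
      exact (congrArg (· + (mfderiv I I (fun z : G => g * z) 1 v : E))
        (map_zero (mfderiv I I (fun z : G => z * 1) g))).trans (zero_add _)
    have h1 : (⟨g * 1, mfderiv I I (fun z : G => g * z) 1 v⟩ : TangentBundle I G) =
        ⟨g, mulInvariantVectorField v g⟩ := by
      have : g * 1 = g := mul_one g
      exact TotalSpace.ext this (by rfl)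
    rw [← h1, ← h0]
    rfl
  rw [he]
  exact S

theorem mulInvariantVectorField_sum {ι : Type*} (s : Finset ι) (v : ι → ℝ)
    (e : ι → GroupLieAlgebra I G) (g : G) :
    mulInvariantVectorField (∑ i ∈ s, v i • e i) g =
      ∑ i ∈ s, v i • mulInvariantVectorField (e i) g := by
  change (mfderiv I I (fun z : G => g * z) 1) _ = _
  rw [map_sum]
  exact Finset.sum_congr rfl fun i _ => map_smul _ _ _

end InvariantFields

section MilnorFrame

open VectorField

variable {G : Type*} [TopologicalSpace G] [ChartedSpace E3 G] [Group G] [LieGroup (𝓡 3) ∞ G]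

/-- The Levi-Civita symbol. -/
def levi (i j k : Fin 3) : ℝ := (((j : ℕ) : ℝ) - i) * (k - i) * (k - j) / 2

theorem milnor_metric
    (h : ContMDiffRiemannianMetric (𝓡 3) ∞ E3 (fun x : G => TangentSpace (𝓡 3) x))
    (hleft : IsLeftInvariantMetric (fun x u v => h.inner x u v))
    {e : Fin 3 → GroupLieAlgebra (𝓡 3) G} {lam : Fin 3 → ℝ}
    (hframe : IsMilnorFrame (fun x u v => h.inner x u v) e lam) (q : G) (x y : Fin 3 → ℝ) :
    h.inner q (∑ i, x i • mulInvariantVectorField (e i) q)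
      (∑ i, y i • mulInvariantVectorField (e i) q) = ∑ i, x i * y i := by
  have key : ∀ i j, h.inner q (mulInvariantVectorField (e i) q)
      (mulInvariantVectorField (e j) q) = if i = j then 1 else 0 := by
    intro i j
    rw [← hframe.orthonormal i j]
    have h1 := hleft q 1 (e i) (e j)
    have h2 : ∀ z : G, q * 1 = z →
        (h.inner z : E3 →L[ℝ] E3 →L[ℝ] ℝ) (mfderiv (𝓡 3) (𝓡 3) (fun z : G => q * z) 1 (e i))
          (mfderiv (𝓡 3) (𝓡 3) (fun z : G => q * z) 1 (e j)) = h.inner 1 (e i) (e j) := by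
      rintro z rfl
      exact h1
    exact h2 q (mul_one q)
  rw [map_sum]
  simp only [map_smul, sum_apply, smul_apply, map_sum, key]
  refine Finset.sum_congr rfl fun i _ => ?_
  simp [mul_comm]

theorem milnor_bracket {h : MetricField (𝓡 3) G} {e : Fin 3 → GroupLieAlgebra (𝓡 3) G}
    {lam : Fin 3 → ℝ} (hframe : IsMilnorFrame h e lam) (i j : Fin 3) (q : G) :
    mlieBracket (𝓡 3) (mulInvariantVectorField (e i)) (mulInvariantVectorField (e j)) q =
      ∑ k, (levi i j k * lam k) • mulInvariantVectorField (e k) q := by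
  have : LieGroup (𝓡 3) (minSmoothness ℝ 3) G :=
    LieGroup.of_le (n := ∞) (by
      rw [minSmoothness_of_isRCLikeNormedField]; exact WithTop.coe_le_coe.2 le_top)
  have hb : ∀ i j k : Fin 3, ∀ r : ℝ, ⁅e i, e j⁆ = r • e k →
      mlieBracket (𝓡 3) (mulInvariantVectorField (e i)) (mulInvariantVectorField (e j)) q =
        r • mulInvariantVectorField (e k) q := by
    intro i j k r hr
    rw [← mulInvariantVector_mlieBracket]
    rw [GroupLieAlgebra.bracket_def] at hr
    rw [hr, mulInvariantVectorField_smul]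
    rfl
  have hs : ∀ i j k : Fin 3, ∀ r : ℝ, ⁅e i, e j⁆ = r • e k →
      mlieBracket (𝓡 3) (mulInvariantVectorField (e j)) (mulInvariantVectorField (e i)) q =
        (-r) • mulInvariantVectorField (e k) q := by
    intro i j k r hr
    rw [mlieBracket_swap_apply, hb i j k r hr, neg_smul]
  have h12 := hb _ _ _ _ hframe.bracket_12
  have h20 := hb _ _ _ _ hframe.bracket_20
  have h01 := hb _ _ _ _ hframe.bracket_01
  have h21 := hs _ _ _ _ hframe.bracket_12
  have h02 := hs _ _ _ _ hframe.bracket_20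
  have h10 := hs _ _ _ _ hframe.bracket_01
  rw [Fin.sum_univ_three]
  fin_cases i <;> fin_cases j <;>
    simp [levi, h12, h20, h01, h21, h02, h10] <;> norm_num

end MilnorFrame

section WarpedFrame

open VectorField

variable {G : Type*} [TopologicalSpace G] [ChartedSpace E3 G] [Group G] [LieGroup (𝓡 3) ∞ G]
  (J : TopologicalSpace.Opens ℝ) (f : ℝ → ℝ)

theorem warpedMetric_apply (h : MetricField (𝓡 3) G) (p : J × G) (u w : ℝ × E3) :
    warpedMetric J f h p u w = u.1 * w.1 + f p.1 ^ 2 * h p.2 u.2 w.2 := by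
  have h1 : ∀ u : ℝ × E3, baseComponent J p u = u.1 := fun u =>
    congrArg (fun L : ℝ × E3 →L[ℝ] ℝ => L u) (mfderiv_fst (I := 𝓘(ℝ, ℝ)) (I' := 𝓡 3) (x := p))
  have h2 : ∀ u : ℝ × E3, fiberComponent J p u = u.2 := fun u =>
    congrArg (fun L : ℝ × E3 →L[ℝ] E3 => L u) (mfderiv_snd (I := 𝓘(ℝ, ℝ)) (I' := 𝓡 3) (x := p))
  change baseComponent J p u * baseComponent J p w + f p.1 ^ 2 *
    h p.2 (fiberComponent J p u) (fiberComponent J p w) = _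
  rw [h1, h1, h2, h2]

/-- The orthonormal frame `∂_t, e_i / f` of the warped product. -/
def warpedFrame (e : Fin 3 → GroupLieAlgebra (𝓡 3) G) :
    Option (Fin 3) → VField (𝓘(ℝ, ℝ).prod (𝓡 3)) (J × G)
  | none => prodField (unitField J) 0
  | some i => (fun p : J × G => (f p.1)⁻¹) • prodField 0 (mulInvariantVectorField (e i))

/-- The structure functions of `warpedFrame`. -/
def warpedStructure (lam : Fin 3 → ℝ) :
    Option (Fin 3) → Option (Fin 3) → Option (Fin 3) → J × G → ℝ
  | none, some i, some k => fun p => if i = k then -(deriv f p.1 / f p.1) else 0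
  | some i, none, some k => fun p => if i = k then deriv f p.1 / f p.1 else 0
  | some i, some j, some k => fun p => levi i j k * lam k / f p.1
  | _, _, _ => fun _ => 0

theorem warpedFrame_sum (e : Fin 3 → GroupLieAlgebra (𝓡 3) G) (p : J × G)
    (x : Option (Fin 3) → ℝ) :
    ∑ i, x i • warpedFrame J f e i p =
      ((x none, ∑ i, (x (some i) * (f p.1)⁻¹) • mulInvariantVectorField (e i) p.2) :
        ℝ × E3) := by
  have key : ∀ (r : ℝ) (L : Fin 3 → E3) (X : Option (Fin 3) → ℝ × E3), X none = (1, 0) →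
      (∀ i, X (some i) = (r • (0 : ℝ), r • L i)) →
      ∑ i, x i • X i = (x none, ∑ i, (x (some i) * r) • L i) := by
    intro r L X h0 h1
    rw [Fintype.sum_option, h0]
    simp only [h1]
    refine Prod.ext ?_ ?_
    · simp [Prod.fst_sum]
    · simp [Prod.snd_sum, smul_smul]
  exact key (f p.1)⁻¹ (fun i => mulInvariantVectorField (e i) p.2)
    (fun i => warpedFrame J f e i p) rfl fun i => rfl

theorem isSmoothVField_zero {E : Type*} [NormedAddCommGroup E] [NormedSpace ℝ E]
    {H : Type*} [TopologicalSpace H] {I : ModelWithCorners ℝ E H}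
    {M : Type*} [TopologicalSpace M] [ChartedSpace H M] [IsManifold I ∞ M] :
    IsSmoothVField (0 : VField I M) :=
  contMDiff_zeroSection ℝ (fun q : M => TangentSpace I q)

variable {J f}

theorem contMDiff_timeFunction {u : ℝ → ℝ} (hu : ContDiffOn ℝ ∞ u J) :
    ContMDiff (𝓘(ℝ, ℝ).prod (𝓡 3)) 𝓘(ℝ, ℝ) ∞ (fun p : J × G => u p.1) :=
  (contMDiff_comp_val J hu).comp contMDiff_fst

theorem mvfderiv_timeFunction {u : ℝ → ℝ} (hu : ContDiffOn ℝ ∞ u J) (p : J × G) (w : ℝ × E3) :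
    mvfderiv (𝓘(ℝ, ℝ).prod (𝓡 3)) (fun p : J × G => u p.1) p w = deriv u p.1 * w.1 := by
  have hd : HasDerivAt u (deriv u p.1) p.1 :=
    ((hu.contDiffAt (J.isOpen.mem_nhds p.1.2)).differentiableAt (by simp)).hasDerivAt
  have hv : HasMFDerivAt 𝓘(ℝ, ℝ) 𝓘(ℝ, ℝ) (Subtype.val : J → ℝ) p.1
      (ContinuousLinearMap.id ℝ ℝ) := by
    have := ((contMDiff_subtype_val (I := 𝓘(ℝ, ℝ)) (U := J) (n := ∞)).mdifferentiable
      (by simp) p.1).hasMFDerivAt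
    rwa [mfderiv_opens_val] at this
  have hc := (hd.hasFDerivAt.hasMFDerivAt.comp p.1 hv).comp p
    (hasMFDerivAt_fst (I := 𝓘(ℝ, ℝ)) (I' := 𝓡 3) (p : J × G))
  have := hc.mfderiv
  change mfderiv (𝓘(ℝ, ℝ).prod (𝓡 3)) 𝓘(ℝ, ℝ) (fun p : J × G => u p.1) p w = _
  rw [show (fun p : J × G => u p.1) = (u ∘ Subtype.val) ∘ Prod.fst from rfl, this]
  exact mul_comm w.1 (deriv u p.1)

end WarpedFrame

section WarpedFrame

open VectorField

variable {G : Type*} [TopologicalSpace G] [ChartedSpace E3 G] [Group G] [LieGroup (𝓡 3) ∞ G]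
  {J : TopologicalSpace.Opens ℝ} {f : ℝ → ℝ}

theorem isLocalFrameOn_of_metric {E : Type*} [NormedAddCommGroup E] [NormedSpace ℝ E]
    [FiniteDimensional ℝ E]
    {H : Type*} [TopologicalSpace H] {I : ModelWithCorners ℝ E H}
    {M : Type*} [TopologicalSpace M] [ChartedSpace H M] [IsManifold I ∞ M]
    {ι : Type*} [Fintype ι] {g : MetricField I M} {F : ι → VField I M}
    (hF : ∀ i, IsSmoothVField (F i)) (hcard : Fintype.card ι = Module.finrank ℝ E)
    (hg : ∀ p (x y : ι → ℝ), g p (∑ i, x i • F i p) (∑ i, y i • F i p) = ∑ i, x i * y i) :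
    IsLocalFrameOn I E ∞ F Set.univ := by
  have hli : ∀ p, LinearIndependent ℝ (fun i => F i p) := by
    intro p
    rw [Fintype.linearIndependent_iff]
    intro x hx i
    have h1 := hg p x x
    have h2 := hg p 0 0
    simp only [Pi.zero_apply, zero_smul, Finset.sum_const_zero, mul_zero] at h2
    rw [hx, h2] at h1
    have h3 := (Finset.sum_eq_zero_iff_of_nonneg fun i _ => mul_self_nonneg (x i)).1 h1.symm i
      (Finset.mem_univ i)
    exact mul_self_eq_zero.1 h3
  refine ⟨fun {p} _ => hli p, fun {p} _ => ?_, fun i => (hF i).contMDiffOn⟩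
  have : FiniteDimensional ℝ (TangentSpace I p) := inferInstanceAs (FiniteDimensional ℝ E)
  exact ((hli p).span_eq_top_of_card_eq_finrank' hcard).ge

theorem isSmoothVField_warpedFrame (hf : ContDiffOn ℝ ∞ f J) (hfpos : ∀ t ∈ J, 0 < f t)
    (e : Fin 3 → GroupLieAlgebra (𝓡 3) G) (i : Option (Fin 3)) :
    IsSmoothVField (warpedFrame J f e i) := by
  match i with
  | none => exact isSmoothVField_prodField (isSmoothVField_unitField J) isSmoothVField_zero
  | some i =>
    exact (contMDiff_timeFunction (G := G) (hf.inv fun t ht => (hfpos t ht).ne')).smul_section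
      (isSmoothVField_prodField (isSmoothVField_zero (M := J))
        (mulInvariantVectorField_smooth (e i)))

theorem warpedFrame_metric
    {h : ContMDiffRiemannianMetric (𝓡 3) ∞ E3 (fun x : G => TangentSpace (𝓡 3) x)}
    (hleft : IsLeftInvariantMetric (fun x u v => h.inner x u v))
    {e : Fin 3 → GroupLieAlgebra (𝓡 3) G} {lam : Fin 3 → ℝ}
    (hframe : IsMilnorFrame (fun x u v => h.inner x u v) e lam)
    (hfpos : ∀ t ∈ J, 0 < f t) (p : J × G) (x y : Option (Fin 3) → ℝ) :
    warpedMetric J f (fun x u w => h.inner x u w) p (∑ i, x i • warpedFrame J f e i p)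
      (∑ i, y i • warpedFrame J f e i p) = ∑ i, x i * y i := by
  have hp := (hfpos p.1 p.1.2).ne'
  rw [warpedFrame_sum, warpedFrame_sum]
  refine (warpedMetric_apply J f (fun x u w => h.inner x u w) p _ _).trans ?_
  have hm := milnor_metric h hleft hframe p.2 (fun i => x (some i) * (f p.1)⁻¹)
    (fun i => y (some i) * (f p.1)⁻¹)
  have hs : x none * y none + f p.1 ^ 2 *
      ∑ i, x (some i) * (f p.1)⁻¹ * (y (some i) * (f p.1)⁻¹) = ∑ i, x i * y i := by
    rw [Fintype.sum_option, Finset.mul_sum]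
    refine congrArg _ (Finset.sum_congr rfl fun i _ => ?_)
    field_simp
  exact (congrArg (fun r : ℝ => x none * y none + f p.1 ^ 2 * r) hm).trans hs

theorem warpedStructure_smooth (hf : ContDiffOn ℝ ∞ f J) (hfpos : ∀ t ∈ J, 0 < f t)
    (lam : Fin 3 → ℝ) (i j k : Option (Fin 3)) :
    ContMDiff (𝓘(ℝ, ℝ).prod (𝓡 3)) 𝓘(ℝ, ℝ) ∞ (warpedStructure (G := G) (J := J) f lam i j k) := by
  have hne : ∀ t ∈ J, f t ≠ 0 := fun t ht => (hfpos t ht).ne'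
  have hd : ContDiffOn ℝ ∞ (deriv f) J := hf.deriv_of_isOpen J.isOpen (by simp)
  match i, j, k with
  | none, some i, some k =>
    exact contMDiff_timeFunction (u := fun t => if i = k then -(deriv f t / f t) else 0) (by
      split_ifs
      · exact (hd.div hf hne).neg
      · exact contDiffOn_const)
  | some i, none, some k =>
    exact contMDiff_timeFunction (u := fun t => if i = k then deriv f t / f t else 0) (by
      split_ifs
      · exact hd.div hf hne
      · exact contDiffOn_const)
  | some i, some j, some k =>
    exact contMDiff_timeFunction (u := fun t => levi i j k * lam k / f t)
      (contDiffOn_const.div hf hne)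
  | none, none, none => exact contMDiff_const
  | none, none, some _ => exact contMDiff_const
  | none, some _, none => exact contMDiff_const
  | some _, none, none => exact contMDiff_const
  | some _, some _, none => exact contMDiff_const

theorem prodField_zero_smul_sum {p : J × G} (w : Fin 3 → ℝ) (r : ℝ)
    (e : Fin 3 → GroupLieAlgebra (𝓡 3) G) (hr : r ≠ 0) :
    prodField (0 : VField 𝓘(ℝ, ℝ) J)
      (fun q => ∑ k, w k • mulInvariantVectorField (e k) q) p =
      ∑ k, (w k * r) • (r⁻¹ • prodField (0 : VField 𝓘(ℝ, ℝ) J)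
        (mulInvariantVectorField (e k)) p) := by
  have key : ∀ (L : Fin 3 → E3), (((0 : ℝ), ∑ k, w k • L k) : ℝ × E3) =
      ∑ k, (w k * r) • (r⁻¹ • (((0 : ℝ), L k) : ℝ × E3)) := by
    intro L
    refine Prod.ext ?_ ?_
    · simp [Prod.fst_sum]
    · simp [Prod.snd_sum, smul_smul, hr]
  exact key fun k => mulInvariantVectorField (e k) p.2

section StructureSum

variable {W : Type*} [AddCommGroup W] [Module ℝ W] (f : ℝ → ℝ) (lam : Fin 3 → ℝ)
  (X : Option (Fin 3) → W) (p : J × G)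

theorem warpedStructure_sum_none_none :
    ∑ d, warpedStructure J f lam none none d p • X d = 0 := by
  rw [Fintype.sum_option]
  simp [warpedStructure]

theorem warpedStructure_sum_none_some (i : Fin 3) :
    ∑ d, warpedStructure J f lam none (some i) d p • X d =
      -(deriv f p.1 / f p.1) • X (some i) := by
  rw [Fintype.sum_option]
  simp [warpedStructure, ite_smul]

theorem warpedStructure_sum_some_none (i : Fin 3) :
    ∑ d, warpedStructure J f lam (some i) none d p • X d =
      (deriv f p.1 / f p.1) • X (some i) := by
  rw [Fintype.sum_option]
  simp [warpedStructure, ite_smul]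

theorem warpedStructure_sum_some_some (i j : Fin 3) :
    ∑ d, warpedStructure J f lam (some i) (some j) d p • X d =
      ∑ k, (levi i j k * lam k / f p.1) • X (some k) := by
  rw [Fintype.sum_option]
  simp [warpedStructure]

end StructureSum

theorem warpedFrame_bracket (hf : ContDiffOn ℝ ∞ f J) (hfpos : ∀ t ∈ J, 0 < f t)
    {h : MetricField (𝓡 3) G} {e : Fin 3 → GroupLieAlgebra (𝓡 3) G} {lam : Fin 3 → ℝ}
    (hframe : IsMilnorFrame h e lam) (i j : Option (Fin 3)) (p : J × G) :
    mlieBracket (𝓘(ℝ, ℝ).prod (𝓡 3)) (warpedFrame J f e i) (warpedFrame J f e j) p =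
      ∑ d, warpedStructure J f lam i j d p • warpedFrame J f e d p := by
  have hp := (hfpos p.1 p.1.2).ne'
  have hne : ∀ t ∈ J, f t ≠ 0 := fun t ht => (hfpos t ht).ne'
  have hT := isSmoothVField_unitField J
  have hX : ∀ i, IsSmoothVField (mulInvariantVectorField (e i)) := fun i =>
    mulInvariantVectorField_smooth (e i)
  have h0J : IsSmoothVField (0 : VField 𝓘(ℝ, ℝ) J) := isSmoothVField_zero
  have h0G : IsSmoothVField (0 : VField (𝓡 3) G) := isSmoothVField_zero
  have hu : MDifferentiableAt (𝓘(ℝ, ℝ).prod (𝓡 3)) 𝓘(ℝ, ℝ) (fun p : J × G => (f p.1)⁻¹) p :=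
    (contMDiff_timeFunction (G := G) (hf.inv hne)).mdifferentiableAt (by simp)
  have hY : ∀ i, MDifferentiableAt (𝓘(ℝ, ℝ).prod (𝓡 3)) (𝓘(ℝ, ℝ).prod (𝓡 3)).tangent
      (fun q : J × G => (⟨q, prodField (0 : VField 𝓘(ℝ, ℝ) J) (mulInvariantVectorField (e i)) q⟩ :
        TangentBundle (𝓘(ℝ, ℝ).prod (𝓡 3)) (J × G))) p := fun i =>
    (isSmoothVField_prodField h0J (hX i)).mdifferentiableAt p
  have hdf : deriv (fun t => (f t)⁻¹) p.1 = -(deriv f p.1) / f p.1 ^ 2 := by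
    have hd : HasDerivAt f (deriv f p.1) p.1 :=
      ((hf.contDiffAt (J.isOpen.mem_nhds p.1.2)).differentiableAt (by simp)).hasDerivAt
    exact (hd.inv hp).deriv
  have hdu : ∀ w : ℝ × E3, mvfderiv (𝓘(ℝ, ℝ).prod (𝓡 3)) (fun p : J × G => (f p.1)⁻¹) p w =
      -(deriv f p.1) / f p.1 ^ 2 * w.1 := fun w => by
    rw [← hdf]; exact mvfderiv_timeFunction (hf.inv hne) p w
  have hns : ∀ i, mlieBracket (𝓘(ℝ, ℝ).prod (𝓡 3)) (warpedFrame J f e none)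
      (warpedFrame J f e (some i)) p =
      -(deriv f p.1 / f p.1) • warpedFrame J f e (some i) p := by
    intro i
    have hb : mlieBracket (𝓘(ℝ, ℝ).prod (𝓡 3)) (warpedFrame J f e none)
        (prodField 0 (mulInvariantVectorField (e i))) p = 0 := by
      refine (mlieBracket_prodField hT h0G h0J (hX i) p).trans ?_
      rw [mlieBracket_zero_left, mlieBracket_zero_right]
      rfl
    refine (mlieBracket_smul_right hu (hY i)).trans ?_
    rw [hb, smul_zero, add_zero]
    have h1 : mvfderiv (𝓘(ℝ, ℝ).prod (𝓡 3)) (fun p : J × G => (f p.1)⁻¹) p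
        (warpedFrame J f e none p) = -(deriv f p.1 / f p.1) * (f p.1)⁻¹ := by
      refine (hdu (warpedFrame J f e none p)).trans ?_
      change -(deriv f p.1) / f p.1 ^ 2 * 1 = _
      field_simp
    rw [h1, mul_smul]
    rfl
  match i, j with
  | none, none =>
    rw [mlieBracket_self, warpedStructure_sum_none_none]
    rfl
  | none, some i =>
    rw [hns, warpedStructure_sum_none_some]
  | some i, none =>
    rw [mlieBracket_swap_apply, hns, warpedStructure_sum_some_none, neg_smul, neg_neg]
  | some i, some j =>
    rw [warpedStructure_sum_some_some]
    have hb : mlieBracket (𝓘(ℝ, ℝ).prod (𝓡 3)) (prodField 0 (mulInvariantVectorField (e i)))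
        (prodField 0 (mulInvariantVectorField (e j))) p =
        ∑ k, (levi i j k * lam k * f p.1) • ((f p.1)⁻¹ • prodField (0 : VField 𝓘(ℝ, ℝ) J)
          (mulInvariantVectorField (e k)) p) := by
      refine (mlieBracket_prodField h0J (hX i) h0J (hX j) p).trans ?_
      rw [mlieBracket_zero_left, funext fun q => milnor_bracket hframe i j q]
      exact prodField_zero_smul_sum _ _ e hp
    have h1 : ∀ i, mvfderiv (𝓘(ℝ, ℝ).prod (𝓡 3)) (fun p : J × G => (f p.1)⁻¹) p
        (prodField 0 (mulInvariantVectorField (e i)) p) = 0 := fun i =>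
      (hdu (prodField 0 (mulInvariantVectorField (e i)) p)).trans (mul_zero _)
    have h2 : mvfderiv (𝓘(ℝ, ℝ).prod (𝓡 3)) (fun p : J × G => (f p.1)⁻¹) p
        (warpedFrame J f e (some j) p) = 0 := by
      refine (hdu (warpedFrame J f e (some j) p)).trans ?_
      change _ * ((f p.1)⁻¹ • (0 : ℝ)) = 0
      rw [smul_zero, mul_zero]
    have h3 : mlieBracket (𝓘(ℝ, ℝ).prod (𝓡 3)) (prodField 0 (mulInvariantVectorField (e i)))
        (warpedFrame J f e (some j)) p =
        (f p.1)⁻¹ • ∑ k, (levi i j k * lam k * f p.1) • ((f p.1)⁻¹ •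
          prodField (0 : VField 𝓘(ℝ, ℝ) J) (mulInvariantVectorField (e k)) p) := by
      refine (mlieBracket_smul_right hu (hY j)).trans ?_
      rw [h1, zero_smul, zero_add, hb]
    refine (mlieBracket_smul_left hu (hY i)).trans ?_
    rw [h2, neg_zero, zero_smul, zero_add, h3, smul_smul, Finset.smul_sum]
    refine Finset.sum_congr rfl fun k _ => ?_
    rw [smul_smul]
    change _ = (levi i j k * lam k / f p.1) • ((f p.1)⁻¹ •
          prodField (0 : VField 𝓘(ℝ, ℝ) J) (mulInvariantVectorField (e k)) p)
    congr 1
    field_simp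

theorem isOrthonormalFrame_warped
    {h : ContMDiffRiemannianMetric (𝓡 3) ∞ E3 (fun x : G => TangentSpace (𝓡 3) x)}
    (hleft : IsLeftInvariantMetric (fun x u v => h.inner x u v))
    {e : Fin 3 → GroupLieAlgebra (𝓡 3) G} {lam : Fin 3 → ℝ}
    (hframe : IsMilnorFrame (fun x u v => h.inner x u v) e lam)
    (hf : ContDiffOn ℝ ∞ f J) (hfpos : ∀ t ∈ J, 0 < f t) :
    IsOrthonormalFrame (warpedMetric J f (fun x u w => h.inner x u w)) (warpedFrame J f e)
      (warpedStructure J f lam) where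
  frame := isLocalFrameOn_of_metric (isSmoothVField_warpedFrame hf hfpos e) (by simp)
    (warpedFrame_metric hleft hframe hfpos)
  metric := warpedFrame_metric hleft hframe hfpos
  bracket := warpedFrame_bracket hf hfpos hframe
  smooth := warpedStructure_smooth hf hfpos lam

end WarpedFrame

section WarpedLaplacian

open VectorField

variable {G : Type*} [TopologicalSpace G] [ChartedSpace E3 G] [Group G] [LieGroup (𝓡 3) ∞ G]
  {J : TopologicalSpace.Opens ℝ} {f φ : ℝ → ℝ}

theorem mvfderiv_timeFunction_none {u : ℝ → ℝ} (hu : ContDiffOn ℝ ∞ u J)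
    (e : Fin 3 → GroupLieAlgebra (𝓡 3) G) (p : J × G) :
    mvfderiv (𝓘(ℝ, ℝ).prod (𝓡 3)) (fun p : J × G => u p.1) p (warpedFrame J f e none p) =
      deriv u p.1 :=
  (mvfderiv_timeFunction hu p (warpedFrame J f e none p)).trans (mul_one _)

theorem mvfderiv_timeFunction_some {u : ℝ → ℝ} (hu : ContDiffOn ℝ ∞ u J)
    (e : Fin 3 → GroupLieAlgebra (𝓡 3) G) (i : Fin 3) (p : J × G) :
    mvfderiv (𝓘(ℝ, ℝ).prod (𝓡 3)) (fun p : J × G => u p.1) p (warpedFrame J f e (some i) p) =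
      0 := by
  refine (mvfderiv_timeFunction hu p (warpedFrame J f e (some i) p)).trans ?_
  change _ * ((f p.1)⁻¹ • (0 : ℝ)) = 0
  rw [smul_zero, mul_zero]

/-- The components of `φ ∂_t + ∑ v_i e_i` in the frame `warpedFrame`. -/
def warpedCoord (f φ : ℝ → ℝ) (v : Fin 3 → ℝ) : Option (Fin 3) → ℝ → ℝ
  | none => φ
  | some i => fun t => f t * v i

theorem sumField_eq (hfpos : ∀ t ∈ J, 0 < f t) (e : Fin 3 → GroupLieAlgebra (𝓡 3) G)
    (v : Fin 3 → ℝ) (p : J × G) :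
    sumField J φ (mulInvariantVectorField (∑ i, v i • e i)) p =
      ∑ a, warpedCoord f φ v a p.1 • warpedFrame J f e a p := by
  have hp := (hfpos p.1 p.1.2).ne'
  refine Eq.trans ?_ (warpedFrame_sum J f e p fun a => warpedCoord f φ v a p.1).symm
  refine Prod.ext rfl ?_
  refine (mulInvariantVectorField_sum Finset.univ v e p.2).trans ?_
  have hv : ∀ i, v i = warpedCoord f φ v (some i) p.1 * (f p.1)⁻¹ := fun i => by
    change v i = f p.1 * v i * (f p.1)⁻¹
    field_simp
  simp only [← hv]
  rfl

theorem contDiffOn_warpedCoord (hf : ContDiffOn ℝ ∞ f J) (hφ : ContDiffOn ℝ ∞ φ J)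
    (v : Fin 3 → ℝ) (a : Option (Fin 3)) : ContDiffOn ℝ ∞ (warpedCoord f φ v a) J := by
  match a with
  | none => exact hφ
  | some i => exact hf.mul contDiffOn_const

theorem isSmoothVField_sumField (hφ : ContDiffOn ℝ ∞ φ J) (w : GroupLieAlgebra (𝓡 3) G) :
    IsSmoothVField (sumField J φ (mulInvariantVectorField w)) := by
  have h1 := (contMDiff_timeFunction (G := G) hφ).smul_section
    (isSmoothVField_prodField (isSmoothVField_unitField J) (isSmoothVField_zero (M := G)
      (I := 𝓡 3)))
  have h2 := isSmoothVField_prodField (isSmoothVField_zero (M := J) (I := 𝓘(ℝ, ℝ)))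
    (mulInvariantVectorField_smooth w)
  have h3 := h1.add_section h2
  have he : sumField J φ (mulInvariantVectorField w) = fun p : J × G =>
      φ p.1 • prodField (unitField J) (0 : VField (𝓡 3) G) p +
        prodField (0 : VField 𝓘(ℝ, ℝ) J) (mulInvariantVectorField w) p := by
    funext p
    have key : ∀ (r : ℝ) (L : E3), ((r, L) : ℝ × E3) = r • ((1, 0) : ℝ × E3) + (0, L) := by
      intro r L
      simp
    exact key _ _
  rw [he]
  exact h3

/-- The components `⟨∇_{F_a} V, F_d⟩` for `V = φ ∂_t + ∑ v_i e_i`. -/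
def warpedCovDeriv (f φ : ℝ → ℝ) (lam v : Fin 3 → ℝ) :
    Option (Fin 3) → Option (Fin 3) → ℝ → ℝ
  | none, none => deriv φ
  | none, some k => fun t => deriv f t * v k
  | some i, none => fun t => -(deriv f t * v i)
  | some i, some k => fun t => (if i = k then φ t * (deriv f t / f t) else 0) +
      milnorMu lam i * ∑ j, v j * levi i j k

theorem contDiffOn_warpedCovDeriv (hf : ContDiffOn ℝ ∞ f J) (hfpos : ∀ t ∈ J, 0 < f t)
    (hφ : ContDiffOn ℝ ∞ φ J) (lam v : Fin 3 → ℝ) (a d : Option (Fin 3)) :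
    ContDiffOn ℝ ∞ (warpedCovDeriv f φ lam v a d) J := by
  have hne : ∀ t ∈ J, f t ≠ 0 := fun t ht => (hfpos t ht).ne'
  have hdf : ContDiffOn ℝ ∞ (deriv f) J := hf.deriv_of_isOpen J.isOpen (by simp)
  have hdφ : ContDiffOn ℝ ∞ (deriv φ) J := hφ.deriv_of_isOpen J.isOpen (by simp)
  match a, d with
  | none, none => exact hdφ
  | none, some k => exact hdf.mul contDiffOn_const
  | some i, none => exact (hdf.mul contDiffOn_const).neg
  | some i, some k =>
    refine ContDiffOn.add ?_ contDiffOn_const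
    by_cases hik : i = k
    · simp only [hik, if_true]
      exact hφ.mul (hdf.div hf hne)
    · simp only [hik, if_false]
      exact contDiffOn_const

section Koszul

variable (f : ℝ → ℝ) (lam : Fin 3 → ℝ) (p : J × G) (x : Option (Fin 3) → ℝ)

theorem koszul_warped_none (b d : Option (Fin 3)) :
    koszul (warpedStructure J f lam) none b d p = 0 := by
  match b, d with
  | none, none => simp [koszul, warpedStructure]
  | none, some k => simp [koszul, warpedStructure]
  | some i, none => simp [koszul, warpedStructure]
  | some i, some k =>
    simp only [koszul, warpedStructure, eq_comm (a := k)]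
    split_ifs <;> ring

theorem koszul_warped_some_none (i : Fin 3) :
    ∑ b, x b * koszul (warpedStructure J f lam) (some i) b none p =
      -(deriv f p.1 / f p.1 * x (some i)) := by
  rw [Fintype.sum_option, Fin.sum_univ_three]
  simp only [koszul, warpedStructure]
  fin_cases i <;> simp <;> ring

theorem koszul_warped_some_some (i k : Fin 3) :
    ∑ b, x b * koszul (warpedStructure J f lam) (some i) b (some k) p =
      (if i = k then x none * (deriv f p.1 / f p.1) else 0) +
        milnorMu lam i * (∑ j, x (some j) * levi i j k) / f p.1 := by
  rw [Fintype.sum_option, Fin.sum_univ_three, Fin.sum_univ_three]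
  simp only [koszul, warpedStructure, milnorMu, levi]
  fin_cases i <;> fin_cases k <;> simp <;> ring

theorem sum_structure_warped_none :
    ∑ b, warpedStructure J f lam none b b p = -3 * (deriv f p.1 / f p.1) := by
  rw [Fintype.sum_option, Fin.sum_univ_three]
  simp only [warpedStructure, if_true]
  ring

theorem sum_structure_warped_some (i : Fin 3) :
    ∑ b, warpedStructure J f lam (some i) b b p = 0 := by
  rw [Fintype.sum_option, Fin.sum_univ_three]
  simp [warpedStructure, levi]

end Koszul

variable {g : MetricField (𝓘(ℝ, ℝ).prod (𝓡 3)) (J × G)} {e : Fin 3 → GroupLieAlgebra (𝓡 3) G}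
  {lam : Fin 3 → ℝ}

theorem covDeriv_sumField
    (h : IsOrthonormalFrame g (warpedFrame J f e) (warpedStructure J f lam))
    (hf : ContDiffOn ℝ ∞ f J) (hfpos : ∀ t ∈ J, 0 < f t) (hφ : ContDiffOn ℝ ∞ φ J)
    (v : Fin 3 → ℝ) (a d : Option (Fin 3)) (p : J × G) :
    h.covDeriv (sumField J φ (mulInvariantVectorField (∑ i, v i • e i))) a d p =
      warpedCovDeriv f φ lam v a d p.1 := by
  have hp := (hfpos p.1 p.1.2).ne'
  have hc : ∀ d q, h.frame.coeff d q (sumField J φ (mulInvariantVectorField (∑ i, v i • e i)) q) =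
      warpedCoord f φ v d q.1 := fun d q => by
    rw [sumField_eq hfpos e v q, h.coeff_sum q]
  have hx := contDiffOn_warpedCoord hf hφ v
  rw [IsOrthonormalFrame.covDeriv]
  simp only [hc]
  have hd : HasDerivAt f (deriv f p.1) p.1 :=
    ((hf.contDiffAt (J.isOpen.mem_nhds p.1.2)).differentiableAt (by simp)).hasDerivAt
  match a, d with
  | none, none =>
    rw [mvfderiv_timeFunction_none (hx none)]
    simp [koszul_warped_none, warpedCoord, warpedCovDeriv]
  | none, some k =>
    rw [mvfderiv_timeFunction_none (hx (some k))]
    simp only [koszul_warped_none, mul_zero, Finset.sum_const_zero, add_zero]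
    exact (hd.mul_const (v k)).deriv
  | some i, none =>
    rw [mvfderiv_timeFunction_some (hx none), koszul_warped_some_none]
    simp only [warpedCoord, warpedCovDeriv]
    field_simp
    ring
  | some i, some k =>
    rw [mvfderiv_timeFunction_some (hx (some k)), koszul_warped_some_some, zero_add]
    simp only [warpedCoord, warpedCovDeriv, Finset.mul_sum, Finset.sum_div]
    refine congrArg _ (Finset.sum_congr rfl fun j _ => ?_)
    field_simp

theorem roughLaplacian_sumField
    (h : IsOrthonormalFrame g (warpedFrame J f e) (warpedStructure J f lam))
    (hf : ContDiffOn ℝ ∞ f J) (hfpos : ∀ t ∈ J, 0 < f t) (hφ : ContDiffOn ℝ ∞ φ J)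
    (v : Fin 3 → ℝ) (d : Option (Fin 3)) (p : J × G) :
    h.roughLaplacian (sumField J φ (mulInvariantVectorField (∑ i, v i • e i))) d p =
      deriv (warpedCovDeriv f φ lam v none d) p.1 +
        3 * (deriv f p.1 / f p.1) * warpedCovDeriv f φ lam v none d p.1 +
        ∑ i, ∑ b, warpedCovDeriv f φ lam v (some i) b p.1 *
          koszul (warpedStructure J f lam) (some i) b d p := by
  have hP := contDiffOn_warpedCovDeriv hf hfpos hφ lam v
  have hc : ∀ a d, h.covDeriv (sumField J φ (mulInvariantVectorField (∑ i, v i • e i))) a d =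
      fun p => warpedCovDeriv f φ lam v a d p.1 := fun a d =>
    funext fun p => covDeriv_sumField h hf hfpos hφ v a d p
  simp only [IsOrthonormalFrame.roughLaplacian, hc]
  rw [Fintype.sum_option, mvfderiv_timeFunction_none (hP none d), sum_structure_warped_none]
  simp only [koszul_warped_none, mul_zero, Finset.sum_const_zero, add_zero]
  congr 1
  · ring
  · refine Finset.sum_congr rfl fun i _ => ?_
    rw [mvfderiv_timeFunction_some (hP (some i) d), sum_structure_warped_some]
    ring

theorem roughLaplacian_sumField_none
    (h : IsOrthonormalFrame g (warpedFrame J f e) (warpedStructure J f lam))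
    (hf : ContDiffOn ℝ ∞ f J) (hfpos : ∀ t ∈ J, 0 < f t) (hφ : ContDiffOn ℝ ∞ φ J)
    (v : Fin 3 → ℝ) (p : J × G) :
    h.roughLaplacian (sumField J φ (mulInvariantVectorField (∑ i, v i • e i))) none p =
      deriv (deriv φ) p.1 + 3 * (deriv f p.1 / f p.1) * deriv φ p.1 -
        3 * (deriv f p.1 / f p.1) ^ 2 * φ p.1 := by
  rw [roughLaplacian_sumField h hf hfpos hφ]
  simp only [koszul_warped_some_none]
  simp [warpedCovDeriv, levi]
  ring

theorem roughLaplacian_sumField_some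
    (h : IsOrthonormalFrame g (warpedFrame J f e) (warpedStructure J f lam))
    (hf : ContDiffOn ℝ ∞ f J) (hfpos : ∀ t ∈ J, 0 < f t) (hφ : ContDiffOn ℝ ∞ φ J)
    (v : Fin 3 → ℝ) (k : Fin 3) (p : J × G) :
    h.roughLaplacian (sumField J φ (mulInvariantVectorField (∑ i, v i • e i))) (some k) p =
      (f p.1 * deriv (deriv f) p.1 + 2 * deriv f p.1 ^ 2 -
        (∑ i, milnorMu lam i ^ 2 - milnorMu lam k ^ 2)) * v k / f p.1 := by
  have hp := (hfpos p.1 p.1.2).ne'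
  have hdf : ContDiffOn ℝ ∞ (deriv f) J := hf.deriv_of_isOpen J.isOpen (by simp)
  have hd : HasDerivAt (deriv f) (deriv (deriv f) p.1) p.1 :=
    ((hdf.contDiffAt (J.isOpen.mem_nhds p.1.2)).differentiableAt (by simp)).hasDerivAt
  have hd2 : deriv (warpedCovDeriv f φ lam v none (some k)) p.1 = deriv (deriv f) p.1 * v k :=
    (hd.mul_const (v k)).deriv
  rw [roughLaplacian_sumField h hf hfpos hφ, hd2]
  simp only [koszul_warped_some_some, warpedCovDeriv, Fin.sum_univ_three, levi]
  generalize milnorMu lam = m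
  fin_cases k <;> simp <;> field_simp <;> ring

end WarpedLaplacian

section UnimodularAlgebra

/-- The algebraic form of the harmonicity equations for the components of `V₂`. -/
def IsEigenCoord (m : Fin 3 → ℝ) (ε : ℝ) (v : Fin 3 → ℝ) : Prop :=
  ∀ k, (ε - (∑ i, m i ^ 2 - m k ^ 2)) * v k = 0

variable {m v : Fin 3 → ℝ} {ε : ℝ}

theorem sum_of_distinct (w : Fin 3 → ℝ) {i j k : Fin 3} (hij : i ≠ j) (hjk : j ≠ k)
    (hik : i ≠ k) : ∑ a, w a = w i + w j + w k := by
  rw [Fin.sum_univ_three]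
  fin_cases i <;> fin_cases j <;> fin_cases k <;> simp_all <;> ring

theorem forall_of_distinct {P : Fin 3 → Prop} {i j k : Fin 3} (hij : i ≠ j) (hjk : j ≠ k)
    (hik : i ≠ k) : (∀ a, P a) ↔ P i ∧ P j ∧ P k := by
  refine ⟨fun h => ⟨h i, h j, h k⟩, fun ⟨h1, h2, h3⟩ a => ?_⟩
  have : a = i ∨ a = j ∨ a = k := by omega
  rcases this with rfl | rfl | rfl <;> assumption

theorem isEigenCoord_iff {i j k : Fin 3} (hij : i ≠ j) (hjk : j ≠ k) (hik : i ≠ k) :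
    IsEigenCoord m ε v ↔ (ε - (m j ^ 2 + m k ^ 2)) * v i = 0 ∧
      (ε - (m i ^ 2 + m k ^ 2)) * v j = 0 ∧ (ε - (m i ^ 2 + m j ^ 2)) * v k = 0 := by
  rw [IsEigenCoord, forall_of_distinct hij hjk hik, sum_of_distinct _ hij hjk hik]
  ring_nf

theorem isPlusMinus_iff (hv : ∑ a, v a ^ 2 = 1) {i j k : Fin 3} (hij : i ≠ j) (hjk : j ≠ k)
    (hik : i ≠ k) : IsPlusMinus v k ↔ v i = 0 ∧ v j = 0 := by
  constructor
  · rintro (rfl | rfl) <;> simp [hik, hjk]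
  · rintro ⟨h1, h2⟩
    rw [sum_of_distinct _ hij hjk hik, h1, h2] at hv
    have hk : v k = 1 ∨ v k = -1 := mul_self_eq_one_iff.1 (by linear_combination hv)
    rcases hk with hk | hk
    · left
      funext a
      revert a
      rw [forall_of_distinct hij hjk hik]
      simp [*]
    · right
      funext a
      revert a
      rw [forall_of_distinct hij hjk hik]
      simp [*]

theorem isEigenCoord_iff_of_eq (hv : ∑ a, v a ^ 2 = 1) (h01 : m 0 ^ 2 = m 1 ^ 2)
    (h12 : m 1 ^ 2 = m 2 ^ 2) : IsEigenCoord m ε v ↔ ε = 2 * m 0 ^ 2 := by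
  rw [isEigenCoord_iff (i := 0) (j := 1) (k := 2) (by decide) (by decide) (by decide),
    ← h12, ← h01, ← two_mul]
  constructor
  · rintro ⟨h1, h2, h3⟩
    rw [Fin.sum_univ_three] at hv
    linear_combination (ε - 2 * m 0 ^ 2) * (-hv) + v 0 * h1 + v 1 * h2 + v 2 * h3
  · rintro rfl
    simp

theorem isEigenCoord_iff_of_eq_ne (hv : ∑ a, v a ^ 2 = 1) {i j k : Fin 3} (hij : i ≠ j)
    (hjk : j ≠ k) (hik : i ≠ k) (he : m i ^ 2 = m j ^ 2) (hne : m i ^ 2 ≠ m k ^ 2) :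
    IsEigenCoord m ε v ↔
      (ε = m i ^ 2 + m k ^ 2 ∧ v k = 0) ∨ (ε = 2 * m i ^ 2 ∧ IsPlusMinus v k) := by
  rw [isEigenCoord_iff hij hjk hik, isPlusMinus_iff hv hij hjk hik, ← he]
  rw [sum_of_distinct _ hij hjk hik] at hv
  constructor
  · rintro ⟨h1, h2, h3⟩
    by_cases hk : v k = 0
    · left
      refine ⟨?_, hk⟩
      rw [hk] at hv
      linear_combination (ε - (m i ^ 2 + m k ^ 2)) * (-hv) + v i * h1 + v j * h2
    · right
      have h4 := (mul_eq_zero.1 h3).resolve_right hk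
      have h5 : ε - (m i ^ 2 + m k ^ 2) ≠ 0 := fun h => hne (by linarith)
      exact ⟨by linarith, (mul_eq_zero.1 h1).resolve_left h5, (mul_eq_zero.1 h2).resolve_left h5⟩
  · rintro (⟨rfl, hk⟩ | ⟨rfl, h1, h2⟩)
    · simp [hk]
    · simp [h1, h2, two_mul]

theorem isEigenCoord_iff_of_ne (hv : ∑ a, v a ^ 2 = 1) (h01 : m 0 ^ 2 ≠ m 1 ^ 2)
    (h12 : m 1 ^ 2 ≠ m 2 ^ 2) (h02 : m 0 ^ 2 ≠ m 2 ^ 2) :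
    IsEigenCoord m ε v ↔ ∃ i j k : Fin 3, i ≠ j ∧ j ≠ k ∧ i ≠ k ∧
      ε = m i ^ 2 + m j ^ 2 ∧ IsPlusMinus v k := by
  have hne : ∀ a b : Fin 3, a ≠ b → m a ^ 2 ≠ m b ^ 2 := by
    intro a b hab
    fin_cases a <;> fin_cases b
    exacts [absurd rfl hab, h01, h02, h01.symm, absurd rfl hab, h12, h02.symm, h12.symm,
      absurd rfl hab]
  constructor
  · intro h
    have hex : ∃ k, v k ≠ 0 := by
      by_contra! h0
      simp [h0] at hv
    obtain ⟨k, hk⟩ := hex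
    have hd : ∃ i j : Fin 3, i ≠ j ∧ j ≠ k ∧ i ≠ k := by
      fin_cases k
      · exact ⟨1, 2, by decide⟩
      · exact ⟨0, 2, by decide⟩
      · exact ⟨0, 1, by decide⟩
    obtain ⟨i, j, hij, hjk, hik⟩ := hd
    obtain ⟨h1, h2, h3⟩ := (isEigenCoord_iff hij hjk hik).1 h
    have h4 := (mul_eq_zero.1 h3).resolve_right hk
    refine ⟨i, j, k, hij, hjk, hik, by linarith, (isPlusMinus_iff hv hij hjk hik).2 ⟨?_, ?_⟩⟩
    · exact (mul_eq_zero.1 h1).resolve_left fun h => hne i k hik (by linarith)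
    · exact (mul_eq_zero.1 h2).resolve_left fun h => hne j k hjk (by linarith)
  · rintro ⟨i, j, k, hij, hjk, hik, rfl, h⟩
    obtain ⟨h1, h2⟩ := (isPlusMinus_iff hv hij hjk hik).1 h
    rw [isEigenCoord_iff hij hjk hik]
    simp [h1, h2]

end UnimodularAlgebra

section CubeRoot

theorem exists_eq_cubeRoot {J : Set ℝ} (hJo : IsOpen J) (hJ : J.OrdConnected) (hJne : J.Nonempty)
    {f : ℝ → ℝ} (hf : ContDiffOn ℝ ∞ f J) (hfpos : ∀ t ∈ J, 0 < f t)
    (hode : ∀ t ∈ J, f t * deriv (deriv f) t + 2 * deriv f t ^ 2 = 0) :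
    ∃ α β : ℝ, ∀ t ∈ J, 0 < α * t + β ∧ f t = (α * t + β) ^ (1 / 3 : ℝ) := by
  have hdf : ContDiffOn ℝ ∞ (deriv f) J := hf.deriv_of_isOpen hJo (by simp)
  have d1 : ∀ t ∈ J, HasDerivAt f (deriv f t) t := fun t ht =>
    ((hf.contDiffAt (hJo.mem_nhds ht)).differentiableAt (by simp)).hasDerivAt
  have d2 : ∀ t ∈ J, HasDerivAt (deriv f) (deriv (deriv f) t) t := fun t ht =>
    ((hdf.contDiffAt (hJo.mem_nhds ht)).differentiableAt (by simp)).hasDerivAt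
  have hconst : ∀ u : ℝ → ℝ, (∀ t ∈ J, HasDerivAt u 0 t) → ∃ a, ∀ t ∈ J, u t = a := by
    intro u hu
    obtain ⟨t₀, ht₀⟩ := hJne
    exact ⟨u t₀, fun t ht => hJo.is_const_of_deriv_eq_zero hJ.isPreconnected
      (fun s hs => (hu s hs).differentiableAt.differentiableWithinAt)
      (fun s hs => (hu s hs).deriv) ht ht₀⟩
  obtain ⟨α, hα⟩ := hconst (fun t => 3 * f t ^ 2 * deriv f t) fun t ht => by
    refine ((((d1 t ht).fun_pow 2).const_mul 3).fun_mul (d2 t ht)).congr_deriv ?_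
    have := hode t ht
    push_cast
    linear_combination 3 * f t * this
  obtain ⟨β, hβ⟩ := hconst (fun t => f t ^ 3 - α * t) fun t ht => by
    refine (((d1 t ht).fun_pow 3).fun_sub ((hasDerivAt_id t).const_mul α)).congr_deriv ?_
    have := hα t ht
    push_cast
    linear_combination this
  refine ⟨α, β, fun t ht => ?_⟩
  have h3 : α * t + β = f t ^ 3 := by
    have := hβ t ht
    linarith
  have hp := hfpos t ht
  rw [h3]
  refine ⟨by positivity, ?_⟩
  rw [one_div]
  exact_mod_cast (Real.pow_rpow_inv_natCast hp.le (n := 3) (by norm_num)).symm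

end CubeRoot

section UnimodularCases

theorem milnorMu_sq_sub (lam : Fin 3 → ℝ) :
    milnorMu lam 0 ^ 2 - milnorMu lam 1 ^ 2 = (lam 1 - lam 0) * lam 2 ∧
    milnorMu lam 1 ^ 2 - milnorMu lam 2 ^ 2 = (lam 2 - lam 1) * lam 0 ∧
    milnorMu lam 0 ^ 2 - milnorMu lam 2 ^ 2 = (lam 2 - lam 0) * lam 1 := by
  simp only [milnorMu]
  refine ⟨by ring, by ring, by ring⟩

theorem unimodularCases_iff {lam : Fin 3 → ℝ} (hsigns : IsNormalizedSigns lam) {J : Set ℝ}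
    (hJo : IsOpen J) (hJ : J.OrdConnected) (hJne : J.Nonempty)
    {f : ℝ → ℝ} (hf : ContDiffOn ℝ ∞ f J) (hfpos : ∀ t ∈ J, 0 < f t) {ε : ℝ}
    (hode : ∀ t ∈ J, f t * deriv (deriv f) t + 2 * deriv f t ^ 2 = ε)
    {v : Fin 3 → ℝ} (hv : ∑ a, v a ^ 2 = 1) :
    UnimodularCases J f lam ε v ↔ IsEigenCoord (milnorMu lam) ε v := by
  obtain ⟨d01, d12, d02⟩ := milnorMu_sq_sub lam
  have n01 : (lam 1 - lam 0) * lam 2 ≠ 0 → milnorMu lam 0 ^ 2 ≠ milnorMu lam 1 ^ 2 :=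
    fun h h' => h (by rw [← d01, h', sub_self])
  have n12 : (lam 2 - lam 1) * lam 0 ≠ 0 → milnorMu lam 1 ^ 2 ≠ milnorMu lam 2 ^ 2 :=
    fun h h' => h (by rw [← d12, h', sub_self])
  have n02 : (lam 2 - lam 0) * lam 1 ≠ 0 → milnorMu lam 0 ^ 2 ≠ milnorMu lam 2 ^ 2 :=
    fun h h' => h (by rw [← d02, h', sub_self])
  have ne : ∀ {a b : ℝ}, a < b ∨ b < a → a - b ≠ 0 := fun h =>
    sub_ne_zero.2 (h.elim (fun h => h.ne) fun h => h.ne')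
  have c1 : lam 0 = 0 → lam 1 = 0 → lam 2 = 0 → (IsEigenCoord (milnorMu lam) ε v ↔ ε = 0) := by
    intro h0 h1 h2
    have hm : ∀ i, milnorMu lam i = 0 := by
      intro i
      fin_cases i <;> simp [milnorMu, h0, h1, h2]
    rw [isEigenCoord_iff_of_eq hv (by simp [hm]) (by simp [hm])]
    simp [hm]
  have c2 : lam 1 = 0 → lam 2 = 0 →
      (IsEigenCoord (milnorMu lam) ε v ↔ ε = 2 * milnorMu lam 0 ^ 2) := fun h1 h2 =>
    isEigenCoord_iff_of_eq hv (sub_eq_zero.1 (by rw [d01, h2, mul_zero]))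
      (sub_eq_zero.1 (by rw [d12, h1, h2, sub_self, zero_mul]))
  have c7 : lam 0 = lam 1 → lam 1 = lam 2 →
      (IsEigenCoord (milnorMu lam) ε v ↔ ε = 2 * milnorMu lam 0 ^ 2) := fun h1 h2 =>
    isEigenCoord_iff_of_eq hv (sub_eq_zero.1 (by rw [d01, h1, sub_self, zero_mul]))
      (sub_eq_zero.1 (by rw [d12, h2, sub_self, zero_mul]))
  have c3 : lam 0 ≠ 0 → lam 1 = 0 → lam 2 ≠ 0 → (IsEigenCoord (milnorMu lam) ε v ↔
      (ε = milnorMu lam 0 ^ 2 + milnorMu lam 1 ^ 2 ∧ v 1 = 0) ∨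
      (ε = 2 * milnorMu lam 0 ^ 2 ∧ IsPlusMinus v 1)) := fun h0 h1 h2 =>
    isEigenCoord_iff_of_eq_ne hv (i := 0) (j := 2) (k := 1) (by decide) (by decide) (by decide)
      (sub_eq_zero.1 (by rw [d02, h1, mul_zero]))
      (n01 (by rw [h1, zero_sub]; exact mul_ne_zero (neg_ne_zero.2 h0) h2))
  have c4 : lam 2 = 0 ∨ lam 0 = lam 1 → lam 1 ≠ 0 → lam 2 - lam 0 ≠ 0 →
      (IsEigenCoord (milnorMu lam) ε v ↔
        (ε = milnorMu lam 0 ^ 2 + milnorMu lam 2 ^ 2 ∧ v 2 = 0) ∨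
        (ε = 2 * milnorMu lam 0 ^ 2 ∧ IsPlusMinus v 2)) := fun h0 h1 h2 =>
    isEigenCoord_iff_of_eq_ne hv (i := 0) (j := 1) (k := 2) (by decide) (by decide) (by decide)
      (sub_eq_zero.1 (by rw [d01]; rcases h0 with h0 | h0 <;> simp [h0])) (n02 (mul_ne_zero h2 h1))
  have c8 : lam 1 = lam 2 → lam 1 ≠ 0 → lam 1 - lam 0 ≠ 0 → (IsEigenCoord (milnorMu lam) ε v ↔
      (ε = milnorMu lam 0 ^ 2 + milnorMu lam 1 ^ 2 ∧ v 0 = 0) ∨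
      (ε = 2 * milnorMu lam 1 ^ 2 ∧ IsPlusMinus v 0)) := fun h0 h1 h2 => by
    rw [add_comm]
    exact isEigenCoord_iff_of_eq_ne hv (i := 1) (j := 2) (k := 0) (by decide) (by decide)
      (by decide) (sub_eq_zero.1 (by rw [d12, h0, sub_self, zero_mul]))
      (n01 (mul_ne_zero h2 (h0 ▸ h1))).symm
  have c6 : lam 1 - lam 0 ≠ 0 → lam 2 - lam 1 ≠ 0 → lam 2 - lam 0 ≠ 0 → lam 0 ≠ 0 → lam 1 ≠ 0 →
      lam 2 ≠ 0 → (IsEigenCoord (milnorMu lam) ε v ↔ ∃ i j k : Fin 3, i ≠ j ∧ j ≠ k ∧ i ≠ k ∧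
      ε = milnorMu lam i ^ 2 + milnorMu lam j ^ 2 ∧ IsPlusMinus v k) := fun a b c x y z =>
    isEigenCoord_iff_of_ne hv (n01 (mul_ne_zero a z)) (n12 (mul_ne_zero b x))
      (n02 (mul_ne_zero c y))
  constructor
  · rintro (⟨h0, h1, h2, h, -⟩ | ⟨-, h1, h2, h⟩ | ⟨h0, h1, h2, h⟩ | ⟨h0, h1, h2, h⟩ |
      ⟨h0, h1, h2, h⟩ | ⟨h0, h⟩ | ⟨h0, h1, h2, h⟩ | ⟨h0, h1, h2, h⟩ | ⟨h0, h1, h2, h⟩)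
    · exact (c1 h0 h1 h2).2 h
    · exact (c2 h1 h2).2 h
    · exact (c3 h0.ne' h1 h2.ne).2 h
    · exact (c4 (Or.inl h2) h1.ne' (ne (Or.inl (by linarith)))).2 h
    · exact (c4 (Or.inr h0) h1.ne' (ne (Or.inl (by linarith)))).2 h
    · rcases h0 with ⟨a, b, c⟩ | ⟨a, b, c⟩
      · exact (c6 (ne (Or.inl a)) (ne (Or.inl (by linarith))) (ne (Or.inl (by linarith)))
          (by linarith : (0 : ℝ) < lam 0).ne' b.ne' c.ne).2 h
      · exact (c6 (ne (Or.inl a)) (ne (Or.inl b)) (ne (Or.inl (by linarith)))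
          (by linarith : (0 : ℝ) < lam 0).ne' (by linarith : (0 : ℝ) < lam 1).ne' c.ne').2 h
    · exact (c7 h0 h1).2 h
    · exact (c8 h1 (h1 ▸ h2.ne') (ne (Or.inl h0))).2 h
    · exact (c4 (Or.inr h0) (by linarith : (0 : ℝ) < lam 1).ne' (ne (Or.inl (by linarith)))).2 h
  · intro h
    rcases hsigns with ⟨h0, h1, h2⟩ | ⟨h0, h1, h2⟩ | ⟨h0, h1, h2⟩ | ⟨h0, h1, h2⟩ | ⟨h0, h1, h2⟩ |
      ⟨h0, h1, h2⟩
    · have hε := (c1 h0 h1 h2).1 h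
      exact Or.inl ⟨h0, h1, h2, hε, exists_eq_cubeRoot hJo hJ hJne hf hfpos (hε ▸ hode)⟩
    · exact Or.inr (Or.inl ⟨h0, h1, h2, (c2 h1 h2).1 h⟩)
    · exact Or.inr (Or.inr (Or.inl ⟨h0, h1, h2, (c3 h0.ne' h1 h2.ne).1 h⟩))
    · exact Or.inr (Or.inr (Or.inr (Or.inl ⟨h0, h1, h2,
        (c4 (Or.inl h2) h1.ne' (ne (Or.inl (by linarith)))).1 h⟩)))
    · rcases h0.eq_or_lt with h0 | h0
      · exact Or.inr (Or.inr (Or.inr (Or.inr (Or.inl ⟨h0.symm, h1, h2,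
          (c4 (Or.inr h0.symm) h1.ne' (ne (Or.inl (by linarith)))).1 h⟩))))
      · exact Or.inr (Or.inr (Or.inr (Or.inr (Or.inr (Or.inl ⟨Or.inl ⟨h0, h1, h2⟩,
          (c6 (ne (Or.inl h0)) (ne (Or.inl (by linarith))) (ne (Or.inl (by linarith)))
          (by linarith : (0 : ℝ) < lam 0).ne' h1.ne' h2.ne).1 h⟩)))))
    · have p1 : 0 < lam 1 := by linarith
      have p0 : 0 < lam 0 := by linarith
      refine Or.inr (Or.inr (Or.inr (Or.inr (Or.inr ?_))))
      rcases h0.eq_or_lt with h0 | h0 <;> rcases h1.eq_or_lt with h1 | h1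
      · exact Or.inr (Or.inl ⟨h0.symm, h1.symm, h2, (c7 h0.symm h1.symm).1 h⟩)
      · exact Or.inr (Or.inr (Or.inr ⟨h0.symm, h1, h2,
          (c4 (Or.inr h0.symm) p1.ne' (ne (Or.inl (by linarith)))).1 h⟩))
      · exact Or.inr (Or.inr (Or.inl ⟨h0, h1.symm, h2,
          (c8 h1.symm p1.ne' (ne (Or.inl h0))).1 h⟩))
      · exact Or.inl ⟨Or.inr ⟨h0, h1, h2⟩, (c6 (ne (Or.inl h0)) (ne (Or.inl h1))
          (ne (Or.inl (by linarith))) p0.ne' p1.ne' h2.ne').1 h⟩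

end UnimodularCases

end

theorem mainTheorem2
    {G : Type*} [TopologicalSpace G] [T2Space G] [ConnectedSpace G]
    [ChartedSpace E3 G] [Group G] [LieGroup (𝓡 3) ∞ G]
    (h : ContMDiffRiemannianMetric (𝓡 3) ∞ E3 (fun x : G => TangentSpace (𝓡 3) x))
    (hleft : IsLeftInvariantMetric (fun x u v => h.inner x u v))
    (e : Fin 3 → GroupLieAlgebra (𝓡 3) G) (lam : Fin 3 → ℝ)
    (hframe : IsMilnorFrame (fun x u v => h.inner x u v) e lam)
    (hsigns : IsNormalizedSigns lam)
    (J : TopologicalSpace.Opens ℝ) (hJne : (J : Set ℝ).Nonempty) (hJ : (J : Set ℝ).OrdConnected)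
    (f φ : ℝ → ℝ) (hf : ContDiffOn ℝ ∞ f J) (hfpos : ∀ t ∈ J, 0 < f t)
    (hφ : ContDiffOn ℝ ∞ φ J)
    (v : Fin 3 → ℝ) (hv : v 0 ^ 2 + v 1 ^ 2 + v 2 ^ 2 = 1) :
    IsHarmonicVectorField (warpedMetric J f (fun x u w => h.inner x u w))
        (sumField J φ (mulInvariantVectorField (∑ i, v i • e i))) ↔
      ∃ ε : ℝ,
        (∀ t ∈ J, f t * deriv (deriv f) t + 2 * deriv f t ^ 2 = ε) ∧
        (∀ t ∈ J, deriv (deriv φ) t + 3 * (deriv f t / f t) * deriv φ t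
          - 3 * (deriv f t / f t) ^ 2 * φ t = 0) ∧
        UnimodularCases J f lam ε v := by
  have hv' : ∑ a, v a ^ 2 = 1 := by rw [Fin.sum_univ_three]; exact hv
  have hF := isOrthonormalFrame_warped hleft hframe hf hfpos
  obtain ⟨t₀, ht₀⟩ := hJne
  have hharm : IsHarmonicVectorField (warpedMetric J f (fun x u w => h.inner x u w))
      (sumField J φ (mulInvariantVectorField (∑ i, v i • e i))) ↔
      (∀ t ∈ J, deriv (deriv φ) t + 3 * (deriv f t / f t) * deriv φ t
          - 3 * (deriv f t / f t) ^ 2 * φ t = 0) ∧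
        ∀ t ∈ J, IsEigenCoord (milnorMu lam) (f t * deriv (deriv f) t + 2 * deriv f t ^ 2) v := by
    rw [hF.isHarmonicVectorField_iff]
    constructor
    · rintro ⟨-, hL⟩
      refine ⟨fun t ht => ?_, fun t ht k => ?_⟩
      · rw [← hL none (⟨t, ht⟩, 1), roughLaplacian_sumField_none hF hf hfpos hφ]
      · have := hL (some k) (⟨t, ht⟩, 1)
        rw [roughLaplacian_sumField_some hF hf hfpos hφ] at this
        exact (div_eq_zero_iff.1 this).resolve_right (hfpos t ht).ne'
    · rintro ⟨h0, hk⟩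
      refine ⟨isSmoothVField_sumField hφ _, fun d p => ?_⟩
      match d with
      | none =>
        rw [roughLaplacian_sumField_none hF hf hfpos hφ]
        exact h0 p.1 p.1.2
      | some k =>
        rw [roughLaplacian_sumField_some hF hf hfpos hφ]
        exact div_eq_zero_iff.2 (Or.inl (hk p.1 p.1.2 k))
  rw [hharm]
  constructor
  · rintro ⟨h0, hk⟩
    obtain ⟨k, hvk⟩ : ∃ k, v k ≠ 0 := by
      by_contra! hz
      simp [hz] at hv
    have hode : ∀ t ∈ J, f t * deriv (deriv f) t + 2 * deriv f t ^ 2 =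
        ∑ i, milnorMu lam i ^ 2 - milnorMu lam k ^ 2 := fun t ht =>
      sub_eq_zero.1 ((mul_eq_zero.1 (hk t ht k)).resolve_right hvk)
    refine ⟨_, hode, h0, ?_⟩
    rw [unimodularCases_iff hsigns J.isOpen hJ ⟨t₀, ht₀⟩ hf hfpos hode hv']
    exact hode t₀ ht₀ ▸ hk t₀ ht₀
  · rintro ⟨ε, hode, h0, hc⟩
    refine ⟨h0, fun t ht => ?_⟩
    rw [unimodularCases_iff hsigns J.isOpen hJ ⟨t₀, ht₀⟩ hf hfpos hode hv'] at hc
    rwa [hode t ht]
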